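/- Let $p$ be a prime number and $n\ge 2$ an integer. All homomorphisms of profinite groups are continuous, and $H^2(Q)=H^2(Q,\mathbb{Z}/p)$ is the profinite cohomology with trivial action on $\mathbb{Z}/p$. For a profinite group $G$ let $G^{(1,p)}=G$ and, for $i\ge1$, let $G^{(i+1,p)}$ be the closed subgroup of $G$ generated by the $p$-th powers of elements of $G^{(i,p)}$ and by $[G,G^{(i,p)}]$ (the lower $p$-central filtration). For $1\le s\le n$ let $\mathbb{U}_{n,s}=\mathbb{U}_s(\mathbb{Z}/p^{n-s+1})$ be the group of unipotent upper-triangular $(s+1)\times(s+1)$ matrices over $\mathbb{Z}/p^{n-s+1}$. Embed $\mathbb{Z}/p$ in it as a central subgroup by $a\mapsto I+p^{n-s}a\,E_{1,s+1}$, let $\bar{\mathbb{U}}_{n,s}=\mathbb{U}_{n,s}/(\mathbb{Z}/p)$, and let $\alpha_{n,s}\in H^2(\bar{\mathbb{U}}_{n,s})$ be the classifying element of the central extension $0\to\mathbb{Z}/p\to\mathbb{U}_{n,s}\to\bar{\mathbb{U}}_{n,s}\to1$. For a profinite group $G$ let $$T(G)=\bigcap_{s=1}^n\ \bigcap_{\rho\colon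 G\to\mathbb{U}_{n,s}}\operatorname{Ker}(\rho),\qquad \bar T(G)=\bigcap_{s=1}^n\ \bigcap_{\rho\colon G\to\bar{\mathbb{U}}_{n,s}}\operatorname{Ker}(\rho),$$ where $\rho$ ranges over all continuous homomorphisms. The $n$-unitriangular elements of $H^2(G/\bar T(G))$ are the pullbacks $\bar\rho^*(\alpha_{n,s})$, for $1\le s\le n$ and continuous homomorphisms $\bar\rho\colon G/\bar T(G)\to\bar{\mathbb{U}}_{n,s}$. Theorem. Let $S$ be a free profinite group, let $N$ be a closed normal subgroup of $S$ contained in $S^{(n,p)}$, and let $G=S/N$. Then: (a) $\bar T(G)=G^{(n,p)}$. (b) One has $T(G)=G^{(n+1,p)}$ if and only if the kernel of the inflation map $\inf\colon H^2(G/G^{(n,p)})\to H^2(G)$ is generated, as a subgroup, by $n$-unitriangular elements. -/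

import Mathlib

open Filter Topology

universe u

/-! ### Profinite groups: freeness and the lower `p`-central filtration

A profinite group is a compact totally disconnected topological group. -/

/-- `B` is a basis of the profinite group `S`: it converges to `1` (every neighbourhood of `1`
contains all but finitely many of its elements), and every map from `B` to a profinite group that
converges to `1` extends uniquely to a continuous homomorphism on `S`. -/
def IsFreeProfiniteBasis {S : Type u} [Group S] [TopologicalSpace S] (B : Set S) : Prop :=
  Tendsto (fun b : B => (b : S)) cofinite (𝓝 1) ∧
    ∀ (H : Type u) [Group H] [TopologicalSpace H] [IsTopologicalGroup H] [CompactSpace H]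
      [TotallyDisconnectedSpace H] (f : B → H), Tendsto f cofinite (𝓝 1) →
        ∃! φ : S →ₜ* H, ∀ b : B, φ (b : S) = f b

/-- A profinite group is free if it has a basis. -/
def IsFreeProfinite (S : Type u) [Group S] [TopologicalSpace S] : Prop :=
  ∃ B : Set S, IsFreeProfiniteBasis B

section LowerPCentral

variable (p : ℕ) (G : Type u) [Group G] [TopologicalSpace G] [IsTopologicalGroup G]

/-- The lower `p`-central filtration of a topological group: `G^(1,p) = G`, and `G^(n+1,p)` is the
closed subgroup generated by the `p`-th powers of elements of `G^(n,p)` and by `[G, G^(n,p)]`.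
(The value at `0`, which is not used, is `G`.) -/
def lowerPCentral : ℕ → Subgroup G
  | 0 => ⊤
  | 1 => ⊤
  | n + 2 =>
    (Subgroup.closure ((fun x : G => x ^ p) '' (lowerPCentral (n + 1) : Set G)) ⊔
      ⁅(⊤ : Subgroup G), lowerPCentral (n + 1)⁆).topologicalClosure

instance lowerPCentral_normal : ∀ n : ℕ, (lowerPCentral p G n).Normal
  | 0 => inferInstanceAs (⊤ : Subgroup G).Normal
  | 1 => inferInstanceAs (⊤ : Subgroup G).Normal
  | n + 2 => by
    have ih := lowerPCentral_normal (n + 1)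
    have h1 : (Subgroup.closure
        ((fun x : G => x ^ p) '' (lowerPCentral p G (n + 1) : Set G))).Normal := by
      refine ⟨fun a ha g => ?_⟩
      induction ha using Subgroup.closure_induction with
      | mem x hx =>
        obtain ⟨y, hy, rfl⟩ := hx
        refine Subgroup.subset_closure ⟨g * y * g⁻¹, ih.conj_mem y hy g, ?_⟩
        simp [conj_pow]
      | one => simp
      | mul x y _ _ hx hy =>
        have h := mul_mem hx hy
        simpa [mul_assoc] using h
      | inv x _ hx =>
        have h := inv_mem hx
        simpa [mul_assoc] using h
    unfold lowerPCentral
    exact Subgroup.is_normal_topologicalClosure _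

end LowerPCentral

/-- `T^U(G)`: the intersection of the kernels of all continuous homomorphisms `G → U`. -/
def kernelIntersection (U : Type*) [Group U] [TopologicalSpace U]
    (G : Type*) [Group G] [TopologicalSpace G] : Subgroup G :=
  ⨅ ρ : G →ₜ* U, ρ.toMonoidHom.ker

/-! ### The second cohomology group with coefficients in `ℤ/p` -/

section Cohomology

variable (p : ℕ) (Q : Type*) [Group Q] [TopologicalSpace Q]

/-- Continuous (inhomogeneous) `2`-cocycles of `Q` with values in the discrete trivial
module `ℤ/p`. -/
def contCocycles₂ : AddSubgroup C(Q × Q, ZMod p) where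
  carrier := {f | ∀ x y z : Q, f (y, z) + f (x, y * z) = f (x * y, z) + f (x, y)}
  zero_mem' := by intro x y z; simp
  add_mem' := by
    intro f g hf hg x y z
    have h1 := hf x y z
    have h2 := hg x y z
    simp only [ContinuousMap.add_apply]
    linear_combination h1 + h2
  neg_mem' := by
    intro f hf x y z
    have h1 := hf x y z
    simp only [ContinuousMap.neg_apply]
    linear_combination -h1

variable [IsTopologicalGroup Q]

/-- The coboundary `(δ g)(x, y) = g y - g (x y) + g x` of a continuous `1`-cochain. -/
def contCoboundary₁ : C(Q, ZMod p) →+ C(Q × Q, ZMod p) where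
  toFun g := ⟨fun x => g x.2 - g (x.1 * x.2) + g x.1, by fun_prop⟩
  map_zero' := by ext x; simp
  map_add' g h := by ext x; simp; ring

/-- The profinite cohomology group `H²(Q) = H²(Q, ℤ/p)`: continuous `2`-cocycles modulo
coboundaries of continuous `1`-cochains. -/
abbrev H2 : Type _ :=
  contCocycles₂ p Q ⧸ (contCoboundary₁ p Q).range.addSubgroupOf (contCocycles₂ p Q)

variable {Q}
variable {Q' : Type*} [Group Q'] [TopologicalSpace Q'] [IsTopologicalGroup Q']

/-- Pullback of cocycles along a continuous homomorphism. -/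
def contCocycles₂.pullback (φ : Q →ₜ* Q') : contCocycles₂ p Q' →+ contCocycles₂ p Q where
  toFun f := ⟨⟨fun x => f.1 (φ x.1, φ x.2), by fun_prop⟩, by
    intro x y z
    simpa using f.2 (φ x) (φ y) (φ z)⟩
  map_zero' := rfl
  map_add' _ _ := rfl

/-- The map `φ^* : H²(Q') → H²(Q)` induced by a continuous homomorphism `φ : Q → Q'`. -/
def H2.map (φ : Q →ₜ* Q') : H2 p Q' →+ H2 p Q :=
  QuotientAddGroup.map _ _ (contCocycles₂.pullback p φ) (by
    rintro ⟨f, hf⟩ ⟨g, hg⟩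
    refine ⟨g.comp ⟨φ, by fun_prop⟩, ?_⟩
    have hg' : contCoboundary₁ p Q' g = f := hg
    subst hg'
    ext x
    change g (φ x.2) - g (φ (x.1 * x.2)) + g (φ x.1) =
      g (φ x.2) - g (φ x.1 * φ x.2) + g (φ x.1)
    rw [map_mul])

/-- The inflation map `H²(G/K) → H²(G)`, induced by the projection `G → G/K`. -/
def H2.inflation (K : Subgroup Q) [K.Normal] : H2 p (Q ⧸ K) →+ H2 p Q :=
  H2.map p ⟨QuotientGroup.mk' K, QuotientGroup.continuous_mk⟩

end Cohomology

/-! ### The classifying element of a central extension by `ℤ/p` -/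

section Extension

variable {p : ℕ} {E Q : Type*} [Group E] [Group Q]
  (ω : GroupExtension (Multiplicative (ZMod p)) E Q)

/-- The set-theoretic section used to define the factor set of an extension. -/
noncomputable def extSection : Q → E := Function.surjInv ω.rightHom_surjective

theorem exists_factorSet (x y : Q) :
    ∃ a : Multiplicative (ZMod p),
      ω.inl a * extSection ω (x * y) = extSection ω x * extSection ω y := by
  have hs : ∀ z, ω.rightHom (extSection ω z) = z :=
    Function.surjInv_eq ω.rightHom_surjective
  have : extSection ω x * extSection ω y * (extSection ω (x * y))⁻¹ ∈ ω.inl.range := by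
    rw [ω.range_inl_eq_ker_rightHom, MonoidHom.mem_ker]
    simp [hs]
  obtain ⟨a, ha⟩ := this
  exact ⟨a, by rw [ha]; simp⟩

/-- The factor set `c` of an extension with respect to the section `σ = extSection ω`, given by
`σ(x) σ(y) = c(x, y) σ(x y)`. -/
noncomputable def factorSet (x y : Q) : ZMod p :=
  (Classical.choose (exists_factorSet ω x y)).toAdd

theorem factorSet_spec (x y : Q) :
    ω.inl (Multiplicative.ofAdd (factorSet ω x y)) * extSection ω (x * y) =
      extSection ω x * extSection ω y :=
  Classical.choose_spec (exists_factorSet ω x y)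

theorem factorSet_cocycle (hω : ∀ (a : Multiplicative (ZMod p)) (e : E), Commute (ω.inl a) e)
    (x y z : Q) :
    factorSet ω y z + factorSet ω x (y * z) = factorSet ω (x * y) z + factorSet ω x y := by
  apply Multiplicative.ofAdd.injective
  apply ω.inl_injective
  apply mul_right_cancel (b := extSection ω (x * y * z))
  have e1 := factorSet_spec ω y z
  have e2 := factorSet_spec ω x (y * z)
  have e3 := factorSet_spec ω (x * y) z
  have e4 := factorSet_spec ω x y
  have h1 := (hω (Multiplicative.ofAdd (factorSet ω y z)) (extSection ω x)).eq
  have h2 := (hω (Multiplicative.ofAdd (factorSet ω (x * y) z))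
    (ω.inl (Multiplicative.ofAdd (factorSet ω x y)))).eq
  rw [← mul_assoc] at e2
  rw [ofAdd_add, ofAdd_add, map_mul, map_mul, mul_assoc, e2, ← mul_assoc, h1, mul_assoc, e1, h2,
    mul_assoc, e3, ← mul_assoc, ← mul_assoc, e4]

variable [TopologicalSpace Q] [DiscreteTopology Q]

/-- The classifying element in `H²(Q)` of a central extension of a discrete group `Q` by `ℤ/p`:
the class of its factor set (it does not depend on the section). -/
noncomputable def classifyingElement
    (hω : ∀ (a : Multiplicative (ZMod p)) (e : E), Commute (ω.inl a) e) : H2 p Q :=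
  QuotientAddGroup.mk
    (⟨⟨fun x => factorSet ω x.1 x.2, continuous_of_discreteTopology⟩,
      factorSet_cocycle ω hω⟩ : contCocycles₂ p Q)

end Extension

/-! ### Unitriangular matrices -/

section Unitriangular

/-- The group of unipotent upper-triangular matrices of size `(s + 1) × (s + 1)` over `R`. -/
def unitriangularSubgroup (s : ℕ) (R : Type) [CommRing R] :
    Subgroup (Matrix (Fin (s + 1)) (Fin (s + 1)) R)ˣ where
  carrier := {M | (∀ i, M.1 i i = 1) ∧ ∀ i j, j < i → M.1 i j = 0}
  one_mem' := ⟨fun i => by simp, fun i j h => by simp [h.ne']⟩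
  mul_mem' := by
    rintro M N ⟨hM1, hM⟩ ⟨hN1, hN⟩
    refine ⟨fun i => ?_, fun i j hij => ?_⟩
    · rw [Units.val_mul, Matrix.mul_apply, Finset.sum_eq_single i]
      · rw [hM1, hN1, one_mul]
      · intro k _ hk
        rcases lt_or_gt_of_ne hk with h | h
        · rw [hM i k h, zero_mul]
        · rw [hN k i h, mul_zero]
      · simp
    · rw [Units.val_mul, Matrix.mul_apply]
      refine Finset.sum_eq_zero fun k _ => ?_
      rcases lt_or_ge k i with h | h
      · rw [hM i k h, zero_mul]
      · rw [hN k j (hij.trans_le h), mul_zero]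
  inv_mem' := by
    rintro M ⟨hM1, hM⟩
    have hinv : ∀ i j, j < i → (M⁻¹).1 i j = 0 := by
      let _ := M.invertible
      have h : Matrix.BlockTriangular M.1 id := fun i j hij => hM i j hij
      have h' := Matrix.blockTriangular_inv_of_blockTriangular h
      intro i j hij
      have := h' (i := i) (j := j) hij
      rwa [← Matrix.coe_units_inv] at this
    refine ⟨fun i => ?_, hinv⟩
    have h : (M.1 * (M⁻¹).1) i i = 1 := by
      rw [← Units.val_mul, mul_inv_cancel]
      simp
    rw [Matrix.mul_apply, Finset.sum_eq_single i, hM1, one_mul] at h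
    · exact h
    · intro k _ hk
      rcases lt_or_gt_of_ne hk with h | h
      · rw [hM i k h, zero_mul]
      · rw [hinv k i h, mul_zero]
    · simp

/-- `U_s(R)`: the group of unipotent upper-triangular matrices of size `(s + 1) × (s + 1)`
over a finite ring `R`, with the discrete topology. -/
def UT (s : ℕ) (R : Type) [CommRing R] : Type := unitriangularSubgroup s R

variable (s : ℕ) (R : Type) [CommRing R]

instance : Group (UT s R) := inferInstanceAs (Group (unitriangularSubgroup s R))

instance : TopologicalSpace (UT s R) := ⊥

instance : DiscreteTopology (UT s R) := ⟨rfl⟩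

variable {s R}

/-- The underlying matrix of an element of `U_s(R)`. -/
def UT.toMatrix (M : UT s R) : Matrix (Fin (s + 1)) (Fin (s + 1)) R :=
  M.1.1

theorem UT.toMatrix_mul (M N : UT s R) : (M * N).toMatrix = M.toMatrix * N.toMatrix := rfl

theorem UT.toMatrix_one : (1 : UT s R).toMatrix = 1 := rfl

theorem UT.toMatrix_injective : Function.Injective (UT.toMatrix : UT s R → _) :=
  fun _ _ h => Subtype.ext (Units.ext h)

theorem UT.toMatrix_diag (M : UT s R) (i : Fin (s + 1)) : M.toMatrix i i = 1 := M.2.1 i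

theorem UT.toMatrix_of_lt (M : UT s R) {i j : Fin (s + 1)} (h : j < i) : M.toMatrix i j = 0 :=
  M.2.2 i j h

variable [NeZero s]

theorem fin_zero_lt_last : (0 : Fin (s + 1)) < Fin.last s :=
  Fin.lt_def.2 (by simpa using Nat.pos_of_ne_zero (NeZero.ne s))

variable (s R) in
/-- The embedding `r ↦ I + r E_{1,s+1}` of the additive group of `R` into `U_s(R)`. -/
def cornerHom : Multiplicative R →* UT s R where
  toFun r :=
    ⟨⟨Matrix.transvection 0 (Fin.last s) r.toAdd, Matrix.transvection 0 (Fin.last s) (-r.toAdd),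
      by rw [Matrix.transvection_mul_transvection_same _ _ fin_zero_lt_last.ne]; simp,
      by rw [Matrix.transvection_mul_transvection_same _ _ fin_zero_lt_last.ne]; simp⟩, by
      refine ⟨fun i => ?_, fun i j hij => ?_⟩
      · have : ¬ (0 = i ∧ Fin.last s = i) := fun h => fin_zero_lt_last.ne (h.1.trans h.2.symm)
        simp [Matrix.transvection, this]
      · have : ¬ (0 = i ∧ Fin.last s = j) := by
          rintro ⟨rfl, rfl⟩
          exact absurd hij (by simp)
        simp [Matrix.transvection, this, hij.ne']⟩
  map_one' := by
    apply UT.toMatrix_injective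
    exact Matrix.transvection_zero _ _
  map_mul' a b := by
    apply UT.toMatrix_injective
    exact (Matrix.transvection_mul_transvection_same _ _ fin_zero_lt_last.ne _ _).symm

theorem cornerHom_toMatrix (r : Multiplicative R) :
    (cornerHom s R r).toMatrix = 1 + Matrix.single 0 (Fin.last s) r.toAdd := rfl

theorem cornerHom_injective : Function.Injective (cornerHom s R) := by
  intro a b h
  have h := congrFun (congrFun (congrArg UT.toMatrix h) 0) (Fin.last s)
  simpa [cornerHom_toMatrix] using h

theorem cornerHom_commute (r : Multiplicative R) (M : UT s R) : Commute (cornerHom s R r) M := by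
  apply UT.toMatrix_injective
  rw [UT.toMatrix_mul, UT.toMatrix_mul, cornerHom_toMatrix, add_mul, mul_add, one_mul, mul_one]
  congr 1
  ext i j
  by_cases hi : i = 0
  · subst hi
    rw [Matrix.single_mul_apply_same]
    by_cases hj : j = Fin.last s
    · subst hj
      rw [Matrix.mul_single_apply_same, M.toMatrix_diag, M.toMatrix_diag, mul_one, one_mul]
    · rw [Matrix.mul_single_apply_of_ne _ _ _ _ _ hj,
        M.toMatrix_of_lt (lt_of_le_of_ne (Fin.le_last j) hj), mul_zero]
  · rw [Matrix.single_mul_apply_of_ne _ _ _ _ _ hi]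
    by_cases hj : j = Fin.last s
    · subst hj
      rw [Matrix.mul_single_apply_same, M.toMatrix_of_lt (Fin.pos_of_ne_zero hi), zero_mul]
    · rw [Matrix.mul_single_apply_of_ne _ _ _ _ _ hj]

end Unitriangular

/-! ### The extensions `0 → ℤ/p → U_s(ℤ/p^(m+1)) → Ū → 1` -/

section Omega

/-- The embedding `ℤ/p → ℤ/p^(m+1)`, `1 ↦ p^m`. -/
def zmodEmb (p m : ℕ) : ZMod p →+ ZMod (p ^ (m + 1)) :=
  ZMod.lift p ⟨zmultiplesHom _ ((p : ZMod (p ^ (m + 1))) ^ m), by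
    have h : ((p ^ (m + 1) : ℕ) : ZMod (p ^ (m + 1))) = 0 := ZMod.natCast_self _
    push_cast at h
    simpa [pow_succ'] using h⟩

theorem zmodEmb_injective (p m : ℕ) [Fact p.Prime] : Function.Injective (zmodEmb p m) := by
  have hp : p.Prime := Fact.out
  refine (injective_iff_map_eq_zero _).2 fun a ha => ?_
  obtain ⟨k, rfl⟩ := ZMod.intCast_surjective a
  have h : ((k * (p : ℤ) ^ m : ℤ) : ZMod (p ^ (m + 1))) = 0 := by
    simpa [zmodEmb] using ha
  rw [ZMod.intCast_zmod_eq_zero_iff_dvd] at h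
  rw [ZMod.intCast_zmod_eq_zero_iff_dvd]
  push_cast at h
  rw [pow_succ', mul_comm k, mul_comm (p : ℤ)] at h
  exact Int.dvd_of_mul_dvd_mul_left (pow_ne_zero m (by exact_mod_cast hp.ne_zero)) h

variable (p s m : ℕ) [NeZero s]

/-- The embedding of `ℤ/p` as the subgroup `I + p^m (ℤ/p^(m+1)) E_{1,s+1}` of
`U_s(ℤ/p^(m+1))`. -/
def omegaInl : Multiplicative (ZMod p) →* UT s (ZMod (p ^ (m + 1))) :=
  (cornerHom s (ZMod (p ^ (m + 1)))).comp (zmodEmb p m).toMultiplicative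

theorem omegaInl_commute (a : Multiplicative (ZMod p)) (M : UT s (ZMod (p ^ (m + 1)))) :
    Commute (omegaInl p s m a) M :=
  cornerHom_commute _ M

instance omegaInl_range_normal : (omegaInl p s m).range.Normal := by
  refine ⟨?_⟩
  rintro _ ⟨a, rfl⟩ g
  refine ⟨a, ?_⟩
  rw [← (omegaInl_commute p s m a g).eq, mul_inv_cancel_right]

/-- The quotient of `U_s(ℤ/p^(m+1))` by the central subgroup `ℤ/p`. -/
abbrev UTBar : Type := UT s (ZMod (p ^ (m + 1))) ⧸ (omegaInl p s m).range

instance : DiscreteTopology (UTBar p s m) :=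
  QuotientGroup.discreteTopology (isOpen_discrete _)

/-- The central extension `0 → ℤ/p → U_s(ℤ/p^(m+1)) → Ū → 1`. -/
def omegaExt [Fact p.Prime] :
    GroupExtension (Multiplicative (ZMod p)) (UT s (ZMod (p ^ (m + 1)))) (UTBar p s m) where
  inl := omegaInl p s m
  rightHom := QuotientGroup.mk' _
  inl_injective := cornerHom_injective.comp (zmodEmb_injective p m)
  range_inl_eq_ker_rightHom := (QuotientGroup.ker_mk' _).symm
  rightHom_surjective := QuotientGroup.mk'_surjective _

/-- The classifying element in `H²(Ū)` of the extension `0 → ℤ/p → U_s(ℤ/p^(m+1)) → Ū → 1`. -/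
noncomputable def omegaClass [Fact p.Prime] : H2 p (UTBar p s m) :=
  classifyingElement (omegaExt p s m) (omegaInl_commute p s m)

end Omega

/-! ### `T(G)`, `T̄(G)` and the unitriangular elements

For fixed `n`, the relevant extensions are those with middle term `U_s(ℤ/p^(n-s+1))`, where
`1 ≤ s ≤ n`. We write `s = k + 1` with `k : Fin n`, so that `n - s = n - (k + 1)`. -/

section Main

variable (p n : ℕ)

/-- `T(G) = ⋂_{s=1}^n T^U(G)` with `U = U_s(ℤ/p^(n-s+1))`. -/
def TSub (G : Type*) [Group G] [TopologicalSpace G] : Subgroup G :=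
  ⨅ k : Fin n, kernelIntersection (UT ((k : ℕ) + 1) (ZMod (p ^ (n - ((k : ℕ) + 1) + 1)))) G

/-- `T̄(G) = ⋂_{s=1}^n T^Ū(G)` with `Ū` the quotient of `U_s(ℤ/p^(n-s+1))` by `ℤ/p`. -/
def TBarSub (G : Type*) [Group G] [TopologicalSpace G] : Subgroup G :=
  ⨅ k : Fin n, kernelIntersection (UTBar p ((k : ℕ) + 1) (n - ((k : ℕ) + 1))) G

/-- The `n`-unitriangular elements of `H²(Q)`: the pullbacks along continuous homomorphisms
`Q → Ū`, for `1 ≤ s ≤ n`, of the classifying elements of the extensions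
`0 → ℤ/p → U_s(ℤ/p^(n-s+1)) → Ū → 1`. -/
def unitriangularElements [Fact p.Prime] (Q : Type*) [Group Q] [TopologicalSpace Q]
    [IsTopologicalGroup Q] : Set (H2 p Q) :=
  {c | ∃ (k : Fin n) (ρ : Q →ₜ* UTBar p ((k : ℕ) + 1) (n - ((k : ℕ) + 1))),
    c = H2.map p ρ (omegaClass p ((k : ℕ) + 1) (n - ((k : ℕ) + 1)))}

end Main

/-! Call a unitriangular matrix of level `i` if its entries at distance `d` above the diagonal are
divisible by `p ^ (i - d)`. Taking `p`-th powers, and commutators with arbitrary elements, raises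
the level by one. Hence a representation in `U_s(ℤ/p^e)` with `s + e = n + 1` kills `G^(n+1,p)`, and
one in `Ū` kills `G^(n,p)`.

For the converse in (a), a block embedding places each group `U_s` of stage `n - 1` inside a group
`Ū` of stage `n`, so `T̄_n(G) ≤ T_{n-1}(G)`. As `N ≤ S^(n,p)`, it remains to show `T_{n-1}(S) ≤
S^(n,p)` for `S` free. Approximation by finite quotients reduces this to a discrete free group `F`
of finite rank and its Magnus representations: with `n` now any index, if the coefficient of an
element at each nonempty word `w` is divisible by `p ^ (n + 1 - |w|)`, then the element lies in
`F^(n+1,p)` (`magnusKernel_eq_lowerPCentral`). The proof is Lazard elimination. Modulo `F^(n+1,p)`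
the element is a positive word in commutators whose leading forms freely generate an associative
algebra over `ℤ/p`. A letter `c` of least weight is collected to the right, giving `k * c ^ a`,
where `k` is a word in iterated brackets `[c, …, [c, c_j]]`. Independence of leading forms makes `a`
divisible by a power of `p` that puts `c ^ a` in `F^(n+1,p)`, and one continues with `k`.

For (b), let `K = G^(n,p)`. A class in the kernel of inflation is represented by a cocycle whose
inflation is the coboundary of some `g`, and `k ↦ g k - g 1` is a homomorphism `K → ℤ/p` that kills
`G^(n+1,p)`. It determines the class, is determined by it because `n ≥ 2`, and such homomorphisms
separate the points of `K` modulo `G^(n+1,p)`. For unitriangular classes in the kernel they are, up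
to sign, the restrictions to `K` of representations `G → U_{n,s}`. So (b) is duality: these
homomorphisms generate all the others exactly when their common kernel is `G^(n+1,p)`. Compactness
of `K` reduces one direction to finitely many homomorphisms. -/

open scoped commutatorElement

/-! ### The lower `p`-central filtration -/

section LowerPCentralLemmas

variable {p : ℕ} {G : Type u} [Group G] [TopologicalSpace G] [IsTopologicalGroup G]

theorem isClosed_lowerPCentral : ∀ n : ℕ, IsClosed (lowerPCentral p G n : Set G)
  | 0 => isClosed_univ
  | 1 => isClosed_univ
  | _ + 2 => Subgroup.isClosed_topologicalClosure _

theorem pow_mem_lowerPCentral {n : ℕ} (hn : 1 ≤ n) {x : G} (hx : x ∈ lowerPCentral p G n) :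
    x ^ p ∈ lowerPCentral p G (n + 1) := by
  obtain ⟨n, rfl⟩ := Nat.exists_eq_succ_of_ne_zero (by omega : n ≠ 0)
  exact Subgroup.le_topologicalClosure _
    (Subgroup.mem_sup_left (Subgroup.subset_closure ⟨x, hx, rfl⟩))

theorem commutator_mem_lowerPCentral {n : ℕ} (hn : 1 ≤ n) (g : G) {x : G}
    (hx : x ∈ lowerPCentral p G n) : ⁅g, x⁆ ∈ lowerPCentral p G (n + 1) := by
  obtain ⟨n, rfl⟩ := Nat.exists_eq_succ_of_ne_zero (by omega : n ≠ 0)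
  exact Subgroup.le_topologicalClosure _
    (Subgroup.mem_sup_right (Subgroup.commutator_mem_commutator (Subgroup.mem_top g) hx))

/-- The lower `p`-central filtration is the smallest descending sequence of closed subgroups, starting
with `G`, that is compatible with `p`-th powers and commutators. -/
theorem lowerPCentral_succ_le {n : ℕ} (hn : 1 ≤ n) {H : Subgroup G} (hH : IsClosed (H : Set G))
    (hpow : ∀ x ∈ lowerPCentral p G n, x ^ p ∈ H)
    (hcomm : ∀ g : G, ∀ x ∈ lowerPCentral p G n, ⁅g, x⁆ ∈ H) : lowerPCentral p G (n + 1) ≤ H := by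
  obtain ⟨n, rfl⟩ := Nat.exists_eq_succ_of_ne_zero (by omega : n ≠ 0)
  refine Subgroup.topologicalClosure_minimal _ (sup_le ?_ ?_) hH
  · rw [Subgroup.closure_le]
    rintro _ ⟨x, hx, rfl⟩
    exact hpow x hx
  · rw [Subgroup.commutator_le]
    exact fun g _ x hx => hcomm g x hx

theorem lowerPCentral_le_of_filtration (H : ℕ → Subgroup G) (hone : H 1 = ⊤)
    (hclosed : ∀ n, IsClosed (H n : Set G)) (hpow : ∀ n ≥ 1, ∀ x ∈ H n, x ^ p ∈ H (n + 1))
    (hcomm : ∀ n ≥ 1, ∀ g : G, ∀ x ∈ H n, ⁅g, x⁆ ∈ H (n + 1)) :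
    ∀ n ≥ 1, lowerPCentral p G n ≤ H n := by
  intro n hn
  induction n, hn using Nat.le_induction with
  | base => rw [hone]; exact le_top
  | succ n hn ih =>
    exact lowerPCentral_succ_le hn (hclosed _) (fun x hx => hpow n hn x (ih hx))
      (fun g x hx => hcomm n hn g x (ih hx))

theorem lowerPCentral_one : lowerPCentral p G 1 = ⊤ := rfl

theorem lowerPCentral_succ_le_self {n : ℕ} (hn : 1 ≤ n) :
    lowerPCentral p G (n + 1) ≤ lowerPCentral p G n :=
  lowerPCentral_succ_le hn (isClosed_lowerPCentral n) (fun _ hx => pow_mem hx p)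
    (fun g _ hx => mul_mem ((lowerPCentral_normal p G n).conj_mem _ hx g) (inv_mem hx))

theorem lowerPCentral_antitone {m n : ℕ} (hm : 1 ≤ m) (h : m ≤ n) :
    lowerPCentral p G n ≤ lowerPCentral p G m := by
  induction n, h using Nat.le_induction with
  | base => exact le_rfl
  | succ n hn ih => exact (lowerPCentral_succ_le_self (hm.trans hn)).trans ih

theorem lowerPCentral_le_comap {H : Type u} [Group H] [TopologicalSpace H] [IsTopologicalGroup H]
    (φ : G →* H) (hφ : Continuous φ) {n : ℕ} (hn : 1 ≤ n) :
    lowerPCentral p G n ≤ (lowerPCentral p H n).comap φ := by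
  refine lowerPCentral_le_of_filtration (fun n => (lowerPCentral p H n).comap φ) (by
    simp [lowerPCentral_one]) (fun n => (isClosed_lowerPCentral n).preimage hφ) ?_ ?_ n hn
  · intro n hn x hx
    simpa using pow_mem_lowerPCentral hn hx
  · intro n hn g x hx
    simpa using commutator_mem_lowerPCentral hn (φ g) hx

theorem pow_pow_mem_lowerPCentral {n : ℕ} (hn : 1 ≤ n) {x : G} (hx : x ∈ lowerPCentral p G n)
    (k : ℕ) : x ^ p ^ k ∈ lowerPCentral p G (n + k) := by
  induction k with
  | zero => simpa using hx
  | succ k ih =>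
    rw [pow_succ, pow_mul]
    exact pow_mem_lowerPCentral (hn.trans (Nat.le_add_right n k)) ih

end LowerPCentralLemmas

/-! ### Commutators in the lower central series -/

section ThreeSubgroups

open Subgroup

/-- The three subgroups lemma in `G ⧸ N`. -/
theorem commutator_commutator_le_of_rotate {G : Type*} [Group G] {A B C N : Subgroup G} [N.Normal]
    (h1 : ⁅⁅B, C⁆, A⁆ ≤ N) (h2 : ⁅⁅C, A⁆, B⁆ ≤ N) : ⁅⁅A, B⁆, C⁆ ≤ N := by
  have key : ∀ H : Subgroup G, H ≤ N ↔ H.map (QuotientGroup.mk' N) = ⊥ := by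
    intro H
    rw [Subgroup.map_eq_bot_iff, QuotientGroup.ker_mk']
  rw [key, Subgroup.map_commutator, Subgroup.map_commutator] at h1 h2 ⊢
  exact Subgroup.commutator_commutator_eq_bot_of_rotate h1 h2

/-- The lower central series, indexed from `1`, satisfies `[γ_a, γ_b] ≤ γ_{a + b}`. -/
theorem commutator_lowerCentralSeries_le {G : Type*} [Group G] (a b : ℕ) :
    ⁅(⊤ : Subgroup G).lowerCentralSeries a, (⊤ : Subgroup G).lowerCentralSeries b⁆ ≤
      (⊤ : Subgroup G).lowerCentralSeries (a + b + 1) := by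
  induction b generalizing a with
  | zero => exact le_rfl
  | succ b ih =>
    rw [Subgroup.commutator_comm]
    rw [Subgroup.lowerCentralSeries_succ]
    apply commutator_commutator_le_of_rotate
    · rw [Subgroup.commutator_comm ⊤]
      rw [← Subgroup.lowerCentralSeries_succ]
      exact (ih (a + 1)).trans (by rw [show a + 1 + b + 1 = a + (b + 1) + 1 by ring])
    · exact (Subgroup.commutator_mono (ih a) le_rfl)

theorem lowerCentralSeries_le_lowerPCentral (p : ℕ) {G : Type u} [Group G] [TopologicalSpace G]
    [IsTopologicalGroup G] (n : ℕ) :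
    (⊤ : Subgroup G).lowerCentralSeries n ≤ lowerPCentral p G (n + 1) := by
  induction n with
  | zero => exact le_top
  | succ n ih =>
    rw [Subgroup.lowerCentralSeries_succ, Subgroup.commutator_comm, Subgroup.commutator_le]
    exact fun g _ x hx => commutator_mem_lowerPCentral (by omega) g (ih hx)

end ThreeSubgroups

/-! ### The level filtration of unitriangular groups -/

section Level

variable {p s : ℕ} {R : Type} [CommRing R]

/-- Strictly upper triangular matrices whose entry at distance `d` from the diagonal is divisible by
`p ^ (i - d)`. -/
structure IsLevel (p i : ℕ) (X : Matrix (Fin (s + 1)) (Fin (s + 1)) R) : Prop where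
  upper : ∀ a b, b ≤ a → X a b = 0
  dvd : ∀ a b : Fin (s + 1), (p : R) ^ (i - ((b : ℕ) - a)) ∣ X a b

namespace IsLevel

variable {i : ℕ} {X Y : Matrix (Fin (s + 1)) (Fin (s + 1)) R}

theorem mono {j : ℕ} (h : j ≤ i) (hX : IsLevel p i X) : IsLevel p j X :=
  ⟨hX.upper, fun a b => (pow_dvd_pow _ (by omega)).trans (hX.dvd a b)⟩

theorem zero : IsLevel p i (0 : Matrix (Fin (s + 1)) (Fin (s + 1)) R) :=
  ⟨fun _ _ _ => rfl, fun _ _ => dvd_zero _⟩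

theorem add (hX : IsLevel p i X) (hY : IsLevel p i Y) : IsLevel p i (X + Y) :=
  ⟨fun a b h => by simp [hX.upper a b h, hY.upper a b h],
    fun a b => dvd_add (hX.dvd a b) (hY.dvd a b)⟩

theorem neg (hX : IsLevel p i X) : IsLevel p i (-X) :=
  ⟨fun a b h => by simp [hX.upper a b h], fun a b => (dvd_neg).2 (hX.dvd a b)⟩

theorem sub (hX : IsLevel p i X) (hY : IsLevel p i Y) : IsLevel p i (X - Y) := by
  rw [sub_eq_add_neg]
  exact hX.add hY.neg

theorem nsmul (hX : IsLevel p i X) (m : ℕ) : IsLevel p i (m • X) := by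
  induction m with
  | zero => simpa using zero
  | succ m ih => rw [succ_nsmul]; exact ih.add hX

theorem p_nsmul (hX : IsLevel p i X) : IsLevel p (i + 1) (p • X) := by
  refine ⟨fun a b h => by simp [hX.upper a b h], fun a b => ?_⟩
  rw [Matrix.smul_apply, nsmul_eq_mul]
  refine (pow_dvd_pow _ (by omega : _ ≤ (i - ((b : ℕ) - a)) + 1)).trans ?_
  rw [pow_succ']
  exact mul_dvd_mul_left _ (hX.dvd a b)

/-- An intermediate index `c` that contributes to the entry `(a, b)` lies strictly between them, so
`X a c` is at smaller distance from the diagonal and is divisible by one more power of `p`. -/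
theorem mul_right (hX : IsLevel p i X) (hY : ∀ a b, b ≤ a → Y a b = 0) :
    IsLevel p (i + 1) (X * Y) := by
  refine ⟨fun a b h => ?_, fun a b => ?_⟩
  · rw [Matrix.mul_apply]
    refine Finset.sum_eq_zero fun c _ => ?_
    rcases le_or_gt c a with h' | h'
    · rw [hX.upper a c h', zero_mul]
    · rw [hY c b (h.trans h'.le), mul_zero]
  · rw [Matrix.mul_apply]
    refine Finset.dvd_sum fun c _ => ?_
    rcases le_or_gt c a with h' | h'
    · rw [hX.upper a c h', zero_mul]; exact dvd_zero _
    rcases le_or_gt b c with h | h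
    · rw [hY c b h, mul_zero]; exact dvd_zero _
    · refine ((pow_dvd_pow _ ?_).trans (hX.dvd a c)).mul_right _
      have := Fin.lt_def.1 h
      have := Fin.lt_def.1 h'
      omega

theorem mul_left (hX : IsLevel p i X) (hY : ∀ a b, b ≤ a → Y a b = 0) :
    IsLevel p (i + 1) (Y * X) := by
  refine ⟨fun a b h => ?_, fun a b => ?_⟩
  · rw [Matrix.mul_apply]
    refine Finset.sum_eq_zero fun c _ => ?_
    rcases le_or_gt c a with h' | h'
    · rw [hY a c h', zero_mul]
    · rw [hX.upper c b (h.trans h'.le), mul_zero]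
  · rw [Matrix.mul_apply]
    refine Finset.dvd_sum fun c _ => ?_
    rcases le_or_gt c a with h' | h'
    · rw [hY a c h', zero_mul]; exact dvd_zero _
    rcases le_or_gt b c with h | h
    · rw [hX.upper c b h, mul_zero]; exact dvd_zero _
    · refine ((pow_dvd_pow _ ?_).trans (hX.dvd c b)).mul_left _
      have := Fin.lt_def.1 h
      have := Fin.lt_def.1 h'
      omega

/-- Every binomial term of degree at least two contains a product of two strictly upper triangular
factors, which gains a level. -/
theorem one_add_pow (hX : IsLevel p i X) (m : ℕ) :
    IsLevel p (i + 1) ((1 + X) ^ m - 1 - m • X) := by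
  induction m with
  | zero => simpa using zero
  | succ m ih =>
    have : (1 + X) ^ (m + 1) - 1 - (m + 1) • X =
        ((1 + X) ^ m - 1 - m • X) + ((1 + X) ^ m - 1 - m • X) * X + m • (X * X) := by
      rw [pow_succ, succ_nsmul]
      simp only [nsmul_eq_mul]
      noncomm_ring
    rw [this]
    exact (ih.add ((ih.mul_right hX.upper).mono (by omega))).add
      ((hX.mul_right hX.upper).nsmul m)

end IsLevel

theorem UT.sub_one_upper (M : UT s R) (a b : Fin (s + 1)) (h : b ≤ a) :
    (M.toMatrix - 1) a b = 0 := by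
  rcases h.eq_or_lt with rfl | h
  · simp [M.toMatrix_diag]
  · simp [M.toMatrix_of_lt h, Matrix.one_apply_ne h.ne']

/-- The subgroup of `U_s(R)` of the matrices `M` with `M - 1` of level `i`. -/
def levelSubgroup (p s : ℕ) (R : Type) [CommRing R] (i : ℕ) : Subgroup (UT s R) where
  carrier := {M | IsLevel p i (M.toMatrix - 1)}
  one_mem' := by
    change IsLevel p i ((1 : UT s R).toMatrix - 1)
    rw [UT.toMatrix_one, sub_self]
    exact IsLevel.zero
  mul_mem' := by
    intro M N hM hN
    change IsLevel p i ((M * N).toMatrix - 1)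
    have : (M * N).toMatrix - 1 = (M.toMatrix - 1) * (N.toMatrix - 1) + (M.toMatrix - 1) +
        (N.toMatrix - 1) := by
      rw [UT.toMatrix_mul]; noncomm_ring
    rw [this]
    exact (((IsLevel.mul_right hM (UT.sub_one_upper N)).mono (by omega)).add hM).add hN
  inv_mem' := by
    intro M hM
    change IsLevel p i ((M⁻¹).toMatrix - 1)
    have h1 : M.toMatrix * (M⁻¹).toMatrix = 1 := by
      rw [← UT.toMatrix_mul, mul_inv_cancel, UT.toMatrix_one]
    have : (M⁻¹).toMatrix - 1 =
        -((M.toMatrix - 1) + (M.toMatrix - 1) * ((M⁻¹).toMatrix - 1)) := by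
      rw [sub_mul, mul_sub, h1]; noncomm_ring
    rw [this]
    exact (IsLevel.add hM ((IsLevel.mul_right hM (UT.sub_one_upper _)).mono (by omega))).neg

theorem mem_levelSubgroup {i : ℕ} {M : UT s R} :
    M ∈ levelSubgroup p s R i ↔ IsLevel p i (M.toMatrix - 1) := Iff.rfl

theorem levelSubgroup_one : levelSubgroup p s R 1 = ⊤ := by
  refine eq_top_iff.2 fun M _ => ⟨UT.sub_one_upper M, fun a b => ?_⟩
  rcases le_or_gt b a with h | h
  · rw [UT.sub_one_upper M a b h]; exact dvd_zero _
  · have := Fin.lt_def.1 h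
    rw [show 1 - ((b : ℕ) - a) = 0 by omega, pow_zero]
    exact one_dvd _

theorem UT.toMatrix_pow (M : UT s R) (m : ℕ) : (M ^ m).toMatrix = M.toMatrix ^ m := by
  induction m with
  | zero => rfl
  | succ m ih => rw [pow_succ, pow_succ, UT.toMatrix_mul, ih]

theorem pow_mem_levelSubgroup {i : ℕ} {M : UT s R} (hM : M ∈ levelSubgroup p s R i) :
    M ^ p ∈ levelSubgroup p s R (i + 1) := by
  rw [mem_levelSubgroup] at hM ⊢
  have h := hM.one_add_pow p
  have := h.add hM.p_nsmul
  rwa [sub_add_cancel, add_sub_cancel, ← UT.toMatrix_pow] at this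

/-- `⁅g, M⁆ - 1` is `g M - M g` times the inverse of `M g`, and `g M - M g` is the ring commutator
of `g - 1` and `M - 1`. -/
theorem commutator_mem_levelSubgroup {i : ℕ} (g : UT s R) {M : UT s R}
    (hM : M ∈ levelSubgroup p s R i) : ⁅g, M⁆ ∈ levelSubgroup p s R (i + 1) := by
  rw [mem_levelSubgroup] at hM ⊢
  have h1 : ((g * M).toMatrix - (M * g).toMatrix) =
      (g.toMatrix - 1) * (M.toMatrix - 1) - (M.toMatrix - 1) * (g.toMatrix - 1) := by
    simp only [UT.toMatrix_mul]; noncomm_ring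
  have h2 : IsLevel p (i + 1) ((g * M).toMatrix - (M * g).toMatrix) := by
    rw [h1]
    exact (hM.mul_left g.sub_one_upper).sub (hM.mul_right g.sub_one_upper)
  have h3 : (⁅g, M⁆).toMatrix - 1 = ((g * M).toMatrix - (M * g).toMatrix) +
      ((g * M).toMatrix - (M * g).toMatrix) * (((M * g)⁻¹).toMatrix - 1) := by
    have e1 : ⁅g, M⁆ = g * M * (M * g)⁻¹ := by rw [commutatorElement_def]; group
    have e2 : (M * g).toMatrix * ((M * g)⁻¹).toMatrix = 1 := by
      rw [← UT.toMatrix_mul, mul_inv_cancel, UT.toMatrix_one]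
    rw [e1, UT.toMatrix_mul (g * M), mul_sub, sub_mul, e2]
    noncomm_ring
  rw [h3]
  exact h2.add ((h2.mul_right (UT.sub_one_upper _)).mono (by omega))

theorem lowerPCentral_le_level {G : Type u} [Group G] [TopologicalSpace G]
    [IsTopologicalGroup G] (ρ : G →* UT s R) (hρ : Continuous ρ) {n : ℕ} (hn : 1 ≤ n) :
    lowerPCentral p G n ≤ (levelSubgroup p s R n).comap ρ := by
  refine lowerPCentral_le_of_filtration (fun n => (levelSubgroup p s R n).comap ρ) (by
    simp [levelSubgroup_one]) (fun n => ?_) ?_ ?_ n hn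
  · exact (isClosed_discrete (levelSubgroup p s R n : Set (UT s R))).preimage hρ
  · intro n _ x hx
    simpa using pow_mem_levelSubgroup hx
  · intro n _ g x hx
    simpa using commutator_mem_levelSubgroup (ρ g) hx

/-- At level `n + 1` an entry at distance at most `s` is divisible by `p ^ (n + 1 - s)`, which is
zero modulo `p ^ e`. -/
theorem map_eq_one_of_mem_lowerPCentral {G : Type u} [Group G] [TopologicalSpace G]
    [IsTopologicalGroup G] {n e : ℕ} (h : s + e ≤ n + 1) (ρ : G →* UT s (ZMod (p ^ e)))
    (hρ : Continuous ρ) {x : G} (hx : x ∈ lowerPCentral p G (n + 1)) : ρ x = 1 := by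
  have h1 : IsLevel p (n + 1) ((ρ x).toMatrix - 1) := lowerPCentral_le_level ρ hρ (by omega) hx
  apply UT.toMatrix_injective
  rw [UT.toMatrix_one, ← sub_eq_zero]
  ext a b
  have h2 := (pow_dvd_pow (p : ZMod (p ^ e)) (by omega : e ≤ _)).trans (h1.dvd a b)
  have h0 : ((p : ZMod (p ^ e))) ^ e = 0 := by
    rw [← Nat.cast_pow]; exact ZMod.natCast_self _
  rw [h0] at h2
  exact zero_dvd_iff.1 h2

/-- At level `s + m` an entry at distance less than `s` is divisible by `p ^ (m + 1)`, hence zero;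
only the corner survives, as a multiple of `p ^ m`. -/
theorem mem_range_omegaInl_of_mem_levelSubgroup [NeZero s] {m n : ℕ} (hn : s + m = n)
    {M : UT s (ZMod (p ^ (m + 1)))} (h1 : M ∈ levelSubgroup p s (ZMod (p ^ (m + 1))) n) :
    M ∈ (omegaInl p s m).range := by
  rw [mem_levelSubgroup] at h1
  have h0 : ((p : ZMod (p ^ (m + 1)))) ^ (m + 1) = 0 := by
    rw [← Nat.cast_pow]; exact ZMod.natCast_self _
  obtain ⟨r, hr⟩ := h1.dvd 0 (Fin.last s)
  obtain ⟨k, rfl⟩ := ZMod.intCast_surjective r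
  refine ⟨Multiplicative.ofAdd (k : ZMod p), ?_⟩
  apply UT.toMatrix_injective
  have hcorner : ((zmodEmb p m (k : ZMod p))) = (p : ZMod (p ^ (m + 1))) ^ m * k := by
    simp [zmodEmb, mul_comm]
  change (1 : Matrix (Fin (s + 1)) (Fin (s + 1)) (ZMod (p ^ (m + 1)))) +
    Matrix.single 0 (Fin.last s) (zmodEmb p m (k : ZMod p)) = M.toMatrix
  rw [hcorner]
  refine (sub_eq_iff_eq_add'.1 (Eq.symm ?_)).symm
  ext a b
  by_cases hab : a = 0 ∧ b = Fin.last s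
  · obtain ⟨rfl, rfl⟩ := hab
    rw [hr, Matrix.single_apply_same]
    congr 2
    simp only [Fin.val_last, Fin.val_zero]
    omega
  · rw [Matrix.single_apply_of_ne _ _ _ _ _ (fun h => hab ⟨h.1.symm, h.2.symm⟩)]
    rcases le_or_gt b a with h | h
    · exact (h1.upper a b h).symm
    · have hlt := Fin.lt_def.1 h
      have hd : m + 1 ≤ n - ((b : ℕ) - a) := by
        by_contra hcon
        apply hab
        refine ⟨Fin.ext ?_, Fin.ext ?_⟩ <;> simp only [Fin.val_last, Fin.val_zero] <;> omega
      have h2 := (pow_dvd_pow (p : ZMod (p ^ (m + 1))) hd).trans (h1.dvd a b)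
      rw [h0] at h2
      exact (zero_dvd_iff.1 h2).symm

end Level

/-! ### Base change and block embeddings of unitriangular groups -/

section UTConstructions

variable {s : ℕ} {R R' : Type} [CommRing R] [CommRing R']

theorem det_one_add_of_strictUpper (X : Matrix (Fin (s + 1)) (Fin (s + 1)) R)
    (hX : ∀ a b, b ≤ a → X a b = 0) : (1 + X).det = 1 := by
  rw [Matrix.det_of_isUpperTriangular]
  · simp [hX]
  · intro a b hab
    have hab' : b < a := hab
    simp [hX a b hab'.le, Matrix.one_apply_ne hab'.ne']

/-- The unitriangular matrix `1 + X`, where `X` is strictly upper triangular. -/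
noncomputable def UT.ofStrict (X : Matrix (Fin (s + 1)) (Fin (s + 1)) R)
    (hX : ∀ a b, b ≤ a → X a b = 0) : UT s R :=
  ⟨Matrix.nonsingInvUnit (1 + X) (by rw [det_one_add_of_strictUpper X hX]; exact isUnit_one), by
    constructor
    · intro a
      change (1 + X) a a = 1
      simp [hX]
    · intro a b hab
      change (1 + X) a b = 0
      simp [hX a b hab.le, Matrix.one_apply_ne hab.ne']⟩

theorem UT.toMatrix_ofStrict (X : Matrix (Fin (s + 1)) (Fin (s + 1)) R)
    (hX : ∀ a b, b ≤ a → X a b = 0) : (UT.ofStrict X hX).toMatrix = 1 + X := rfl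

/-- The entrywise map `U_s(R) → U_s(R')` induced by a ring homomorphism. -/
noncomputable def UT.map (f : R →+* R') : UT s R →* UT s R' where
  toFun M := UT.ofStrict ((M.toMatrix - 1).map f) (fun a b h => by
    rw [Matrix.map_apply, UT.sub_one_upper M a b h, map_zero])
  map_one' := by
    apply UT.toMatrix_injective
    rw [UT.toMatrix_ofStrict, UT.toMatrix_one, UT.toMatrix_one, sub_self]
    ext; simp
  map_mul' M N := by
    apply UT.toMatrix_injective
    simp only [UT.toMatrix_mul, UT.toMatrix_ofStrict]
    simp only [← RingHom.mapMatrix_apply, map_sub, map_mul, map_one]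
    noncomm_ring

theorem UT.toMatrix_map (f : R →+* R') (M : UT s R) :
    (UT.map f M).toMatrix = M.toMatrix.map f := by
  change 1 + (M.toMatrix - 1).map f = _
  simp only [← RingHom.mapMatrix_apply, map_sub, map_one]
  abel

/-- The block matrix with diagonal blocks `M` and `1`. -/
def blockExtend (M : Matrix (Fin (s + 1)) (Fin (s + 1)) R) :
    Matrix (Fin (s + 1 + 1)) (Fin (s + 1 + 1)) R := fun a b =>
  Fin.lastCases (motive := fun _ => R) (if b = Fin.last (s + 1) then 1 else 0)
    (fun a' => Fin.lastCases (motive := fun _ => R) 0 (fun b' => M a' b') b) a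

theorem blockExtend_castSucc (M : Matrix (Fin (s + 1)) (Fin (s + 1)) R) (a b : Fin (s + 1)) :
    blockExtend M a.castSucc b.castSucc = M a b := by simp [blockExtend]

theorem blockExtend_castSucc_last (M : Matrix (Fin (s + 1)) (Fin (s + 1)) R) (a : Fin (s + 1)) :
    blockExtend M a.castSucc (Fin.last _) = 0 := by simp [blockExtend]

theorem blockExtend_last (M : Matrix (Fin (s + 1)) (Fin (s + 1)) R) (b : Fin (s + 1 + 1)) :
    blockExtend M (Fin.last _) b = if b = Fin.last _ then 1 else 0 := by simp [blockExtend]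

theorem blockExtend_mul (M N : Matrix (Fin (s + 1)) (Fin (s + 1)) R) :
    blockExtend (M * N) = blockExtend M * blockExtend N := by
  ext a b
  rw [Matrix.mul_apply, Fin.sum_univ_castSucc]
  induction a using Fin.lastCases with
  | last => simp [blockExtend_last]
  | cast a =>
    induction b using Fin.lastCases with
    | last => simp [blockExtend_castSucc_last]
    | cast b =>
      simp [blockExtend_castSucc, blockExtend_castSucc_last, Matrix.mul_apply]

theorem blockExtend_one : blockExtend (1 : Matrix (Fin (s + 1)) (Fin (s + 1)) R) = 1 := by
  ext a b
  induction a using Fin.lastCases with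
  | last => rw [blockExtend_last, Matrix.one_apply]; simp [eq_comm]
  | cast a =>
    induction b using Fin.lastCases with
    | last => rw [blockExtend_castSucc_last, Matrix.one_apply_ne (Fin.castSucc_lt_last a).ne]
    | cast b => rw [blockExtend_castSucc]; simp [Matrix.one_apply]

/-- The embedding of `U_s(R)` into `U_{s+1}(R)` as the upper left block. -/
noncomputable def UT.extend : UT s R →* UT (s + 1) R where
  toFun M := ⟨⟨blockExtend M.toMatrix, blockExtend (M⁻¹).toMatrix, by
      rw [← blockExtend_mul, ← UT.toMatrix_mul, mul_inv_cancel, UT.toMatrix_one,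
        blockExtend_one], by
      rw [← blockExtend_mul, ← UT.toMatrix_mul, inv_mul_cancel, UT.toMatrix_one,
        blockExtend_one]⟩, by
      constructor
      · intro a
        induction a using Fin.lastCases with
        | last => simp [blockExtend_last]
        | cast a => simp [blockExtend_castSucc, M.toMatrix_diag]
      · intro a b hab
        induction b using Fin.lastCases with
        | last => exact absurd hab (not_lt.2 (Fin.le_last a))
        | cast b =>
          induction a using Fin.lastCases with
          | last => simp [blockExtend_last, (Fin.castSucc_lt_last b).ne]
          | cast a => simpa [blockExtend_castSucc] using M.toMatrix_of_lt (by simpa using hab)⟩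
  map_one' := by
    apply UT.toMatrix_injective
    exact blockExtend_one
  map_mul' M N := by
    apply UT.toMatrix_injective
    exact blockExtend_mul _ _

theorem UT.toMatrix_extend (M : UT s R) : (UT.extend M).toMatrix = blockExtend M.toMatrix := rfl

theorem UT.extend_injective : Function.Injective (UT.extend : UT s R → UT (s + 1) R) := by
  intro M N h
  apply UT.toMatrix_injective
  ext a b
  have := congrFun (congrFun (congrArg UT.toMatrix h) a.castSucc) b.castSucc
  simpa [UT.toMatrix_extend, blockExtend_castSucc] using this

/-- The embedded block has corner entry zero, so it meets the central `ℤ/p` trivially and `U_s`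
embeds in the `Ū` of the next size. -/
theorem UT.extend_eq_one_of_mem_range (p m : ℕ) (M : UT s (ZMod (p ^ (m + 1))))
    (h : UT.extend M ∈ (omegaInl p (s + 1) m).range) : M = 1 := by
  obtain ⟨a, ha⟩ := h
  apply UT.extend_injective
  rw [map_one, ← ha]
  have h1 := congrFun (congrFun (congrArg UT.toMatrix ha) 0) (Fin.last (s + 1))
  have h2 : (UT.extend M).toMatrix 0 (Fin.last (s + 1)) = 0 :=
    blockExtend_castSucc_last M.toMatrix 0
  rw [h2] at h1
  have h3 : (zmodEmb p m a.toAdd) = 0 := by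
    simpa [omegaInl, cornerHom_toMatrix, Matrix.one_apply_ne fin_zero_lt_last.ne] using h1
  apply UT.toMatrix_injective
  change 1 + Matrix.single 0 (Fin.last (s + 1)) (zmodEmb p m a.toAdd) = 1
  rw [h3]
  simp

end UTConstructions

/-! ### Magnus representations and coefficients of words -/

section Words

variable {X : Type u} [DecidableEq X]

/-- The matrix with `1` at the places `(i, i + 1)` such that the `i`-th letter of `w` is `x`. -/
def wordMatrix (R : Type) [CommRing R] (w : List X) (x : X) :
    Matrix (Fin (w.length + 1)) (Fin (w.length + 1)) R :=
  fun i j => if (j : ℕ) = i + 1 ∧ w[(i : ℕ)]? = some x then 1 else 0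

theorem wordMatrix_upper (R : Type) [CommRing R] (w : List X) (x : X) (a b) (h : b ≤ a) :
    wordMatrix R w x a b = 0 := by
  have := Fin.le_def.1 h
  rw [wordMatrix, if_neg]
  omega

/-- The Magnus representation of the free group attached to a word. -/
noncomputable def magnus (R : Type) [CommRing R] (w : List X) : FreeGroup X →* UT w.length R :=
  FreeGroup.lift fun x => UT.ofStrict (wordMatrix R w x) (wordMatrix_upper R w x)

theorem magnus_of (R : Type) [CommRing R] (w : List X) (x : X) :
    (magnus R w (FreeGroup.of x)).toMatrix = 1 + wordMatrix R w x := by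
  simp [magnus, UT.toMatrix_ofStrict]

theorem map_magnus {R R' : Type} [CommRing R] [CommRing R'] (f : R →+* R') (w : List X)
    (g : FreeGroup X) : UT.map f (magnus R w g) = magnus R' w g := by
  have : (UT.map f).comp (magnus R w) = magnus R' w := by
    ext x
    apply UT.toMatrix_injective
    rw [MonoidHom.comp_apply, UT.toMatrix_map, magnus_of, magnus_of]
    ext i j
    by_cases hij : i = j <;> simp [wordMatrix, hij, apply_ite f]
  exact DFunLike.congr_fun this g

/-- The representation of the free algebra attached to a word. -/
noncomputable def wordEval (K : Type) [CommRing K] (w : List X) :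
    FreeAlgebra K X →ₐ[K] Matrix (Fin (w.length + 1)) (Fin (w.length + 1)) K :=
  FreeAlgebra.lift K (wordMatrix K w)

/-- Each letter of `v` moves one place along the superdiagonal and must agree with the letter of `w`
there; ending in the last column means that `w` is used up. -/
theorem wordEval_word (K : Type) [CommRing K] (w v : List X) (i : Fin (w.length + 1)) :
    wordEval K w (v.map (FreeAlgebra.ι K)).prod i (Fin.last _) =
      if w.drop i = v then 1 else 0 := by
  induction v generalizing i with
  | nil =>
    have : i = Fin.last _ ↔ w.length ≤ (i : ℕ) := by
      rw [Fin.ext_iff, Fin.val_last]; omega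
    simp [Matrix.one_apply, List.drop_eq_nil_iff, this]
  | cons x v ih =>
    rw [List.map_cons, List.prod_cons, map_mul, Matrix.mul_apply]
    simp only [ih]
    rw [wordEval, FreeAlgebra.lift_ι_apply]
    by_cases hi : (i : ℕ) < w.length
    · rw [Finset.sum_eq_single (⟨i + 1, by omega⟩ : Fin (w.length + 1))]
      · rw [List.drop_eq_getElem_cons hi]
        simp only [wordMatrix, List.getElem?_eq_getElem hi, List.cons.injEq]
        split_ifs <;> simp_all
      · intro b _ hb
        rw [wordMatrix, if_neg, zero_mul]
        rintro ⟨h, -⟩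
        exact hb (Fin.ext h)
      · simp
    · rw [Finset.sum_eq_zero, if_neg]
      · rw [List.drop_eq_nil_of_le (by omega)]; simp
      · intro b _
        rw [wordMatrix, if_neg, zero_mul]
        rintro ⟨-, h⟩
        rw [List.getElem?_eq_none (by omega)] at h
        simp at h

theorem basisFreeMonoid_apply_ofList (K : Type*) [CommRing K] {Y : Type*} (v : List Y) :
    FreeAlgebra.basisFreeMonoid K Y (FreeMonoid.ofList v) = (v.map (FreeAlgebra.ι K)).prod := by
  rw [FreeAlgebra.basisFreeMonoid, Module.Basis.map_apply]
  simp [FreeAlgebra.equivMonoidAlgebraFreeMonoid]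

/-- The case `i = 0` of `wordEval_word`, extended linearly: the corner entry reads off the
coefficient of `w`. -/
theorem wordEval_corner (K : Type) [CommRing K] (w : List X) (f : FreeAlgebra K X) :
    wordEval K w f 0 (Fin.last _) =
      (FreeAlgebra.basisFreeMonoid K X).repr f (FreeMonoid.ofList w) := by
  have : (Matrix.entryLinearMap K K (0 : Fin (w.length + 1)) (Fin.last w.length)).comp
      (wordEval K w).toLinearMap =
      (Finsupp.lapply (FreeMonoid.ofList w)).comp
        (FreeAlgebra.basisFreeMonoid K X).repr.toLinearMap := by
    refine (FreeAlgebra.basisFreeMonoid K X).ext fun v => ?_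
    have h : v = FreeMonoid.ofList v.toList := rfl
    simp only [LinearMap.comp_apply, AlgHom.toLinearMap_apply, Matrix.entryLinearMap_apply,
      LinearEquiv.coe_coe, Module.Basis.repr_self, Finsupp.lapply_apply]
    rw [h, basisFreeMonoid_apply_ofList, wordEval_word]
    by_cases h2 : w = v.toList
    · have h3 : v = FreeMonoid.ofList w := by rw [h2]; rfl
      simp [h2]
    · have h3 : v ≠ FreeMonoid.ofList w := fun e => h2 (by rw [e]; rfl)
      simpa [h2] using (Finsupp.single_eq_of_ne' h3).symm
  exact LinearMap.congr_fun this f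

theorem eq_zero_of_wordEval_corner (K : Type) [CommRing K] (f : FreeAlgebra K X)
    (h : ∀ w : List X, wordEval K w f 0 (Fin.last _) = 0) : f = 0 := by
  rw [← (FreeAlgebra.basisFreeMonoid K X).repr.map_eq_zero_iff]
  ext v
  exact (wordEval_corner K v.toList f).symm.trans (h _)

end Words

/-! ### Lazard elimination in free associative algebras -/

section Elimination

/-- The left-normed iterated commutator `[a, [a, …, [a, b]]]` in an associative ring. -/
def iterComm {A : Type*} [Ring A] (a b : A) : ℕ → A
  | 0 => b
  | k + 1 => a * iterComm a b k - iterComm a b k * a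

variable {K : Type*} [Field K] {J : Type*}

/-- The operator `L_z`, prefixing the letter `z`, on the span of `List (J × ℕ) × ℕ`. -/
noncomputable def prefixOp (K : Type*) [Field K] {Z : Type*} (z : Z) :
    Module.End K (List Z × ℕ →₀ K) :=
  Finsupp.lmapDomain K K fun q => (z :: q.1, q.2)

/-- The values of the operator `T` with `T L_{(j, k)} = L_{(j, k + 1)} + L_{(j, k)} T` on the
basis. -/
noncomputable def shiftOpBasis (K : Type*) [Field K] {J : Type*} :
    List (J × ℕ) → ℕ → (List (J × ℕ) × ℕ →₀ K)
  | [], e => Finsupp.single ([], e + 1) 1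
  | z :: l, e => Finsupp.single ((z.1, z.2 + 1) :: l, e) 1 + prefixOp K z (shiftOpBasis K l e)

noncomputable def shiftOp (K : Type*) [Field K] (J : Type*) :
    Module.End K (List (J × ℕ) × ℕ →₀ K) :=
  Finsupp.linearCombination K fun q => shiftOpBasis K q.1 q.2

theorem shiftOp_mul_prefixOp (z : J × ℕ) :
    shiftOp K J * prefixOp K z - prefixOp K z * shiftOp K J = prefixOp K (z.1, z.2 + 1) := by
  have h : shiftOp K J * prefixOp K z =
      prefixOp K (z.1, z.2 + 1) + prefixOp K z * shiftOp K J := by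
    refine Finsupp.lhom_ext fun q c => ?_
    simp [shiftOp, prefixOp, shiftOpBasis, Finsupp.mapDomain_single]
  refine LinearMap.ext fun x => ?_
  rw [LinearMap.sub_apply, h, LinearMap.add_apply]
  exact add_sub_cancel_right _ _

theorem iterComm_shiftOp (j : J) (k : ℕ) :
    iterComm (shiftOp K J) (prefixOp K (j, 0)) k = prefixOp K (j, k) := by
  induction k with
  | zero => rfl
  | succ k ih => rw [iterComm, ih, shiftOp_mul_prefixOp]

theorem map_iterComm {A B F : Type*} [Ring A] [Ring B] [FunLike F A B] [RingHomClass F A B] (f : F)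
    (a b : A) (k : ℕ) :
    f (iterComm a b k) = iterComm (f a) (f b) k := by
  induction k with
  | zero => rfl
  | succ k ih => simp [iterComm, ih]

theorem shiftOp_pow_apply (e : ℕ) :
    (shiftOp K J ^ e) (Finsupp.single ([], 0) 1) = Finsupp.single ([], e) 1 := by
  induction e with
  | zero => simp
  | succ e ih => rw [pow_succ', Module.End.mul_apply, ih]; simp [shiftOp, shiftOpBasis]

theorem prefixOp_list_apply (l : List (J × ℕ)) (e : ℕ) :
    (l.map (prefixOp K)).prod (Finsupp.single ([], e) 1) = Finsupp.single (l, e) 1 := by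
  induction l with
  | nil => simp
  | cons z l ih => simp [ih, prefixOp, Finsupp.mapDomain_single]

/-- Lazard elimination of the letter `i₀`: if the words in the `P i` are linearly independent, then so
are the products of words in the `[P i₀, …, [P i₀, P j]]`, `j ≠ i₀`, with powers of `P i₀`. -/
theorem linearIndependent_elimination {A : Type*} [Ring A] [Algebra K A] {ι : Type*} (P : ι → A)
    (hP : LinearIndependent K fun l : List ι => (l.map P).prod) (i₀ : ι) :
    LinearIndependent K fun q : List ({j // j ≠ i₀} × ℕ) × ℕ =>
      (q.1.map fun z => iterComm (P i₀) (P z.1) z.2).prod * P i₀ ^ q.2 := by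
  classical
  -- By hypothesis the free algebra embeds in `A`, so independence need only be proved in the free
  -- algebra.
  have hinj : Function.Injective (FreeAlgebra.lift K P) := by
    have h : (FreeAlgebra.lift K P).toLinearMap =
        (Finsupp.linearCombination K fun l : FreeMonoid ι => (l.toList.map P).prod).comp
          (FreeAlgebra.basisFreeMonoid K ι).repr.toLinearMap := by
      refine (FreeAlgebra.basisFreeMonoid K ι).ext fun v => ?_
      rw [LinearMap.comp_apply, LinearEquiv.coe_coe, Module.Basis.repr_self,
        Finsupp.linearCombination_single, one_smul, AlgHom.toLinearMap_apply]
      rw [← FreeMonoid.ofList_toList v, basisFreeMonoid_apply_ofList, map_list_prod, List.map_map]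
      congr 2
      ext i
      simp
    intro a b hab
    have h' : ∀ a, FreeAlgebra.lift K P a = _ := fun a => LinearMap.congr_fun h a
    rw [h', h'] at hab
    exact (FreeAlgebra.basisFreeMonoid K ι).repr.injective (hP hab)
  -- In this representation the vector `([], 0)` is sent by the `q`-th product to the basis vector
  -- `q`, which proves independence.
  let Θ : FreeAlgebra K ι →ₐ[K] Module.End K (List ({j // j ≠ i₀} × ℕ) × ℕ →₀ K) :=
    FreeAlgebra.lift K fun j => if h : j = i₀ then shiftOp K {j // j ≠ i₀}
      else prefixOp K (⟨j, h⟩, 0)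
  let v : List ({j // j ≠ i₀} × ℕ) × ℕ → FreeAlgebra K ι := fun q =>
    (q.1.map fun z => iterComm (FreeAlgebra.ι K i₀) (FreeAlgebra.ι K z.1.1) z.2).prod *
      FreeAlgebra.ι K i₀ ^ q.2
  have hΘ : ∀ q, Θ (v q) (Finsupp.single ([], 0) 1) = Finsupp.single q 1 := by
    intro q
    have h0 : Θ (FreeAlgebra.ι K i₀) = shiftOp K {j // j ≠ i₀} := by
      simp [Θ]
    have h1 : ∀ z : {j // j ≠ i₀} × ℕ,
        Θ (iterComm (FreeAlgebra.ι K i₀) (FreeAlgebra.ι K z.1.1) z.2) = prefixOp K z := by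
      intro z
      rw [← iterComm_shiftOp, ← h0]
      rw [map_iterComm]
      congr 1
      simp [Θ, z.1.2]
    have h2 : Θ (v q) = (q.1.map (prefixOp K)).prod * shiftOp K {j // j ≠ i₀} ^ q.2 := by
      simp only [v, map_mul, map_pow, h0, map_list_prod, List.map_map]
      congr 3
      ext1 z
      exact h1 z
    rw [h2, Module.End.mul_apply, shiftOp_pow_apply, prefixOp_list_apply]
  have hv : LinearIndependent K v := by
    let ev : FreeAlgebra K ι →ₗ[K] (List ({j // j ≠ i₀} × ℕ) × ℕ →₀ K) :=
      (LinearMap.applyₗ (Finsupp.single ([], 0) 1)).comp Θ.toLinearMap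
    apply LinearIndependent.of_comp ev
    have : ev ∘ v = fun q => Finsupp.single q 1 := by
      ext1 q
      exact hΘ q
    rw [this]
    exact Finsupp.linearIndependent_single_one K _
  have := hv.map' (FreeAlgebra.lift K P).toLinearMap (LinearMap.ker_eq_bot.2 hinj)
  have e : (FreeAlgebra.lift K P).toLinearMap ∘ v = fun q =>
      (q.1.map fun z => iterComm (P i₀) (P z.1) z.2).prod * P i₀ ^ q.2 := by
    ext1 q
    simp only [v, Function.comp, AlgHom.toLinearMap_apply, map_mul, map_pow,
      FreeAlgebra.lift_ι_apply, map_list_prod, List.map_map]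
    congr 3
    ext1 z
    simp [map_iterComm]
  rwa [e] at this

end Elimination

/-! ### Leading forms of integral unitriangular matrices -/

section Leading

variable {s : ℕ} {p : ℕ}

/-- The integral matrix `m` vanishes at distance less than `d` above the diagonal, and `M` is its reduction
modulo `p` at distance `d`. -/
structure IsLeading (p d : ℕ) (m : Matrix (Fin (s + 1)) (Fin (s + 1)) ℤ)
    (M : Matrix (Fin (s + 1)) (Fin (s + 1)) (ZMod p)) : Prop where
  zero : ∀ i j : Fin (s + 1), (j : ℕ) < i + d → m i j = 0
  lead : ∀ i j : Fin (s + 1), M i j = if (j : ℕ) = i + d then (m i j : ZMod p) else 0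

namespace IsLeading

variable {d e : ℕ} {m m' : Matrix (Fin (s + 1)) (Fin (s + 1)) ℤ}
  {M M' : Matrix (Fin (s + 1)) (Fin (s + 1)) (ZMod p)}

theorem mul (h : IsLeading p d m M) (h' : IsLeading p e m' M') :
    IsLeading p (d + e) (m * m') (M * M') := by
  constructor
  · intro i j hij
    rw [Matrix.mul_apply]
    refine Finset.sum_eq_zero fun k _ => ?_
    by_cases hk : (k : ℕ) < i + d
    · rw [h.zero i k hk, zero_mul]
    · rw [h'.zero k j (by omega), mul_zero]
  · intro i j
    rw [Matrix.mul_apply, Matrix.mul_apply]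
    split_ifs with hij
    · rw [Int.cast_sum]
      refine Finset.sum_congr rfl fun k _ => ?_
      rw [h.lead, h'.lead]
      rcases lt_trichotomy (k : ℕ) (i + d) with hk | hk | hk
      · simp [hk.ne, h.zero i k hk]
      · rw [if_pos hk, if_pos (by omega), Int.cast_mul]
      · rw [if_neg hk.ne', zero_mul, h'.zero k j (by omega), mul_zero, Int.cast_zero]
    · refine Finset.sum_eq_zero fun k _ => ?_
      rw [h.lead, h'.lead]
      by_cases hk : (k : ℕ) = i + d
      · rw [if_neg (by omega : ¬ (j : ℕ) = k + e), mul_zero]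
      · rw [if_neg hk, zero_mul]

theorem sub (h : IsLeading p d m M) (h' : IsLeading p d m' M') :
    IsLeading p d (m - m') (M - M') := by
  constructor
  · intro i j hij
    rw [Matrix.sub_apply, h.zero i j hij, h'.zero i j hij, sub_zero]
  · intro i j
    rw [Matrix.sub_apply, h.lead, h'.lead, Matrix.sub_apply]
    split_ifs <;> simp

theorem unitriangular (g : UT s ℤ) : IsLeading p 0 g.toMatrix 1 := by
  constructor
  · intro i j hij
    exact g.toMatrix_of_lt (Fin.lt_def.2 (by omega))
  · intro i j
    by_cases hij : i = j
    · subst hij; simp [g.toMatrix_diag]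
    · rw [Matrix.one_apply_ne hij, if_neg]
      rw [add_zero]
      exact fun h => hij (Fin.ext h.symm)

/-- The group commutator minus one is the ring commutator of `g - 1` and `h - 1` times a
unitriangular matrix, whose leading form is `1`. -/
theorem commutator {g h : UT s ℤ} (hg : IsLeading p d (g.toMatrix - 1) M)
    (hh : IsLeading p e (h.toMatrix - 1) M') :
    IsLeading p (d + e) ((⁅g, h⁆).toMatrix - 1) (M * M' - M' * M) := by
  have h1 : (⁅g, h⁆).toMatrix - 1 = ((g.toMatrix - 1) * (h.toMatrix - 1) -
      (h.toMatrix - 1) * (g.toMatrix - 1)) * ((h * g)⁻¹).toMatrix := by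
    have e1 : ⁅g, h⁆ = g * h * (h * g)⁻¹ := by rw [commutatorElement_def]; group
    have e2 : (h * g).toMatrix * ((h * g)⁻¹).toMatrix = 1 := by
      rw [← UT.toMatrix_mul, mul_inv_cancel, UT.toMatrix_one]
    have e3 : (g.toMatrix - 1) * (h.toMatrix - 1) - (h.toMatrix - 1) * (g.toMatrix - 1) =
        (g * h).toMatrix - (h * g).toMatrix := by
      simp only [UT.toMatrix_mul]; noncomm_ring
    rw [e3, e1, UT.toMatrix_mul (g * h), sub_mul, e2]
  rw [h1]
  have h2 := hh.mul hg
  rw [add_comm e d] at h2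
  have h3 := ((hg.mul hh).sub h2).mul (unitriangular (p := p) ((h * g)⁻¹))
  rwa [mul_one, add_zero] at h3

theorem pow (h : IsLeading p d m M) (k : ℕ) : IsLeading p (k * d) (m ^ k) (M ^ k) := by
  induction k with
  | zero => simpa [UT.toMatrix_one] using unitriangular (p := p) (1 : UT s ℤ)
  | succ k ih => rw [pow_succ, pow_succ, Nat.succ_mul]; exact ih.mul h

theorem list_prod {ι : Type*} (d : ι → ℕ) (m : ι → Matrix (Fin (s + 1)) (Fin (s + 1)) ℤ)
    (M : ι → Matrix (Fin (s + 1)) (Fin (s + 1)) (ZMod p)) (h : ∀ i, IsLeading p (d i) (m i) (M i))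
    (l : List ι) : IsLeading p (l.map d).sum (l.map m).prod (l.map M).prod := by
  induction l with
  | nil => simpa [UT.toMatrix_one] using unitriangular (p := p) (1 : UT s ℤ)
  | cons i l ih => simpa using (h i).mul ih

end IsLeading

end Leading

/-! ### Divisibility of coefficients from independence of leading forms -/

section FilteredIndependence

variable {X : Type u} [DecidableEq X] {p : ℕ} [Fact p.Prime]

/-- If the leading forms are linearly independent modulo `p`, then an integral combination of the
elements is of high filtration only if all its terms are. -/
theorem dvd_of_combination {I : Type*} (n : ℕ) (d : I → ℕ) (M : I → FreeAlgebra (ZMod p) X)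
    (hM : LinearIndependent (ZMod p) M)
    (m : ∀ w : List X, I → Matrix (Fin (w.length + 1)) (Fin (w.length + 1)) ℤ)
    (hm : ∀ w i, IsLeading p (d i) (m w i) (wordEval (ZMod p) w (M i)))
    (t : Finset I) (α : I → ℤ)
    (h : ∀ w : List X,
      (p : ℤ) ^ (n + 1 - w.length) ∣ ∑ i ∈ t, α i * m w i 0 (Fin.last w.length)) :
    ∀ i ∈ t, (p : ℤ) ^ (n + 1 - d i) ∣ α i := by
  classical
  have hp : p.Prime := Fact.out
  -- The divisibility is improved by one power of `p` at a time.
  have key : ∀ N ≤ n + 1, ∀ i ∈ t, (p : ℤ) ^ (N - d i) ∣ α i := by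
    intro N
    induction N with
    | zero => intro _ i _; simp
    | succ N ih =>
      intro hN i₀ hi₀
      have ih := ih (by omega)
      by_cases hd : N + 1 ≤ d i₀
      · rw [Nat.sub_eq_zero_of_le hd]; simp
      push Not at hd
      set e := d i₀ with he
      choose! β hβ using ih
      let t' := t.filter fun i => d i = e
      -- Only words of length `e` matter. There the terms with `d i < e` are already divisible by `p
      -- ^ (N + 1 - e)` and those with `d i > e` have zero corner. Dividing the rest by `p ^ (N -
      -- e)` and reducing modulo `p` gives a relation among the forms of degree `e`.
      have hcomb : ∑ i ∈ t', ((β i : ℤ) : ZMod p) • M i = 0 := by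
        apply eq_zero_of_wordEval_corner
        intro w
        simp only [map_sum, map_smul, Matrix.sum_apply, Matrix.smul_apply, smul_eq_mul]
        by_cases hw : w.length = e
        · have h1 : (p : ℤ) ^ (N + 1 - e) ∣ ∑ i ∈ t, α i * m w i 0 (Fin.last w.length) :=
            (pow_dvd_pow _ (by omega)).trans (h w)
          rw [← Finset.sum_filter_add_sum_filter_not t (fun i => d i = e)] at h1
          have h2 : (p : ℤ) ^ (N + 1 - e) ∣
              ∑ i ∈ t.filter (fun i => ¬ d i = e), α i * m w i 0 (Fin.last w.length) := by
            refine Finset.dvd_sum fun i hi => ?_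
            rw [Finset.mem_filter] at hi
            rcases lt_or_gt_of_ne hi.2 with hlt | hlt
            · rw [hβ i hi.1, mul_assoc]
              exact (pow_dvd_pow _ (by omega)).mul_right _
            · rw [(hm w i).zero 0 (Fin.last _) (by simp; omega), mul_zero]
              exact dvd_zero _
          have h3 := (Int.dvd_iff_dvd_of_dvd_add h1).2 h2
          have h4 : ∑ i ∈ t', α i * m w i 0 (Fin.last w.length) =
              (p : ℤ) ^ (N - e) * ∑ i ∈ t', β i * m w i 0 (Fin.last w.length) := by
            rw [Finset.mul_sum]
            refine Finset.sum_congr rfl fun i hi => ?_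
            rw [Finset.mem_filter] at hi
            rw [← mul_assoc, ← hi.2, ← hβ i hi.1]
          rw [h4, show N + 1 - e = (N - e) + 1 by omega, pow_succ] at h3
          have h5 := Int.dvd_of_mul_dvd_mul_left
            (pow_ne_zero _ (by exact_mod_cast hp.ne_zero : (p : ℤ) ≠ 0)) h3
          rw [← ZMod.intCast_zmod_eq_zero_iff_dvd, Int.cast_sum] at h5
          rw [← h5]
          refine Finset.sum_congr rfl fun i hi => ?_
          rw [Finset.mem_filter] at hi
          rw [(hm w i).lead, if_pos (by simp [hw, hi.2]), Int.cast_mul]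
        · refine Finset.sum_eq_zero fun i hi => ?_
          rw [Finset.mem_filter] at hi
          rw [(hm w i).lead, if_neg (by simp [hi.2, hw]), mul_zero]
      have hzero := (linearIndependent_iff'.1 hM) t' _ hcomb i₀ (by simp [t', hi₀, he])
      rw [ZMod.intCast_zmod_eq_zero_iff_dvd] at hzero
      rw [hβ i₀ hi₀, show N + 1 - e = (N - e) + 1 by omega, pow_succ]
      exact mul_dvd_mul_left _ hzero
  exact fun i hi => key (n + 1) le_rfl i hi

end FilteredIndependence

/-! ### The Magnus kernel of a free group of finite rank -/

section MagnusKernel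

variable {X : Type u} [DecidableEq X]

/-- The intersection of the kernels of the Magnus representations of words, modulo the powers of `p` that
are adapted to the lengths of the words. -/
noncomputable def magnusKernel (X : Type u) [DecidableEq X] (p n : ℕ) : Subgroup (FreeGroup X) :=
  ⨅ w : List X, (magnus (ZMod (p ^ (n + 1 - w.length))) w).ker

theorem lowerPCentral_le_magnusKernel [TopologicalSpace (FreeGroup X)]
    [DiscreteTopology (FreeGroup X)] [IsTopologicalGroup (FreeGroup X)] (p n : ℕ) :
    lowerPCentral p (FreeGroup X) (n + 1) ≤ magnusKernel X p n := by
  refine le_iInf fun w g hg => ?_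
  rw [MonoidHom.mem_ker]
  by_cases hw : w.length ≤ n + 1
  · exact map_eq_one_of_mem_lowerPCentral (n := n) (by omega) _ continuous_of_discreteTopology hg
  · have h0 : n + 1 - w.length = 0 := by omega
    have : Subsingleton (ZMod (p ^ (n + 1 - w.length))) := by
      rw [h0, pow_zero]
      exact inferInstanceAs (Subsingleton (ZMod 1))
    exact UT.toMatrix_injective (Subsingleton.elim _ _)

theorem dvd_of_mem_magnusKernel {p n : ℕ} {g : FreeGroup X} (hg : g ∈ magnusKernel X p n)
    (w : List X) (i j : Fin (w.length + 1)) :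
    (p : ℤ) ^ (n + 1 - w.length) ∣ ((magnus ℤ w g).toMatrix - 1) i j := by
  have h1 : magnus (ZMod (p ^ (n + 1 - w.length))) w g = 1 := (Subgroup.mem_iInf.1 hg w)
  rw [← map_magnus (Int.castRingHom (ZMod (p ^ (n + 1 - w.length))))] at h1
  have h2 := congrFun (congrFun (congrArg UT.toMatrix h1) i) j
  rw [UT.toMatrix_map, UT.toMatrix_one, Matrix.map_apply] at h2
  have h3 : ((((magnus ℤ w g).toMatrix - 1) i j : ℤ) : ZMod (p ^ (n + 1 - w.length))) = 0 := by
    rw [Matrix.sub_apply, Int.cast_sub, sub_eq_zero]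
    refine Eq.trans h2 ?_
    rw [Matrix.one_apply, Matrix.one_apply]
    split_ifs <;> simp
  rw [ZMod.intCast_zmod_eq_zero_iff_dvd] at h3
  exact_mod_cast h3

/-- A family of iterated commutators in a free group, with weights and with leading forms that generate a
free associative algebra modulo `p`. -/
structure CommutatorFamily (p : ℕ) [Fact p.Prime] (X : Type u) [DecidableEq X] (ι : Type u) where
  elt : ι → FreeGroup X
  weight : ι → ℕ
  form : ι → FreeAlgebra (ZMod p) X
  weight_pos : ∀ i, 1 ≤ weight i
  elt_mem : ∀ i, elt i ∈ (⊤ : Subgroup (FreeGroup X)).lowerCentralSeries (weight i - 1)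
  leading : ∀ (w : List X) (i : ι), IsLeading p (weight i) ((magnus ℤ w (elt i)).toMatrix - 1)
    (wordEval (ZMod p) w (form i))
  indep : LinearIndependent (ZMod p) fun l : List ι => (l.map form).prod

/-- The left-normed iterated commutator `[a, [a, …, [a, b]]]` in a group. -/
def iterBracket {G : Type*} [Group G] (a b : G) : ℕ → G
  | 0 => b
  | k + 1 => ⁅a, iterBracket a b k⁆

theorem iterBracket_mem_lowerCentralSeries {G : Type*} [Group G] {a b : G} {d e : ℕ}
    (hd : 1 ≤ d) (he : 1 ≤ e)
    (ha : a ∈ (⊤ : Subgroup G).lowerCentralSeries (d - 1))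
    (hb : b ∈ (⊤ : Subgroup G).lowerCentralSeries (e - 1)) (k : ℕ) :
    iterBracket a b k ∈ (⊤ : Subgroup G).lowerCentralSeries (e + k * d - 1) := by
  induction k with
  | zero => simpa [iterBracket] using hb
  | succ k ih =>
    have := commutator_lowerCentralSeries_le _ _ (Subgroup.commutator_mem_commutator ha ih)
    rwa [show d - 1 + (e + k * d - 1) + 1 = e + (k + 1) * d - 1 by
      rw [Nat.succ_mul]; omega] at this

namespace CommutatorFamily

variable {p : ℕ} [Fact p.Prime] {ι : Type u}

theorem leading_iterBracket (C : CommutatorFamily p X ι) (w : List X) (i j : ι) (k : ℕ) :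
    IsLeading p (C.weight j + k * C.weight i)
      ((magnus ℤ w (iterBracket (C.elt i) (C.elt j) k)).toMatrix - 1)
      (wordEval (ZMod p) w (iterComm (C.form i) (C.form j) k)) := by
  induction k with
  | zero => simpa [iterBracket, iterComm] using C.leading w j
  | succ k ih =>
    have h := (C.leading w i).commutator ih
    rw [show C.weight i + (C.weight j + k * C.weight i) = C.weight j + (k + 1) * C.weight i by
      ring] at h
    simpa [iterBracket, iterComm, map_commutatorElement] using h

/-- Bounding the number of brackets by `n` keeps the index type finite; longer brackets lie in
`F^(n+1,p)` and are discarded in `mul_closure_elim`. -/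
theorem indep_elim (C : CommutatorFamily p X ι) (i₀ : ι) (n : ℕ) :
    LinearIndependent (ZMod p) fun q : List ({j // j ≠ i₀} × Fin (n + 1)) × ℕ =>
      (q.1.map fun z => iterComm (C.form i₀) (C.form z.1) z.2).prod * C.form i₀ ^ q.2 := by
  have h := linearIndependent_elimination C.form C.indep i₀
  let f : {j // j ≠ i₀} × Fin (n + 1) → {j // j ≠ i₀} × ℕ := fun z => (z.1, z.2)
  have hf : Function.Injective f := by
    rintro ⟨a, b⟩ ⟨c, d⟩ h
    simp only [f, Prod.mk.injEq] at h
    exact Prod.ext h.1 (Fin.ext h.2)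
  have h2 := h.comp (fun q : List ({j // j ≠ i₀} × Fin (n + 1)) × ℕ => (q.1.map f, q.2)) (by
    rintro ⟨a, b⟩ ⟨c, d⟩ h
    simp only [Prod.mk.injEq] at h
    exact Prod.ext (List.map_injective_iff.2 hf h.1) h.2)
  simpa only [Function.comp_def, List.map_map] using h2

/-- The family of the iterated commutators `[c_{i₀}, …, [c_{i₀}, c_j]]` with `j ≠ i₀`. -/
def elim (C : CommutatorFamily p X ι) (i₀ : ι) (n : ℕ) :
    CommutatorFamily p X ({j // j ≠ i₀} × Fin (n + 1)) where
  elt z := iterBracket (C.elt i₀) (C.elt z.1) z.2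
  weight z := C.weight z.1 + z.2 * C.weight i₀
  form z := iterComm (C.form i₀) (C.form z.1) z.2
  weight_pos z := (C.weight_pos z.1).trans (Nat.le_add_right _ _)
  elt_mem z := iterBracket_mem_lowerCentralSeries (C.weight_pos i₀) (C.weight_pos z.1)
    (C.elt_mem i₀) (C.elt_mem z.1) z.2
  leading w z := C.leading_iterBracket w i₀ z.1 z.2
  indep := by
    have h := (C.indep_elim i₀ n).comp (fun l => (l, 0)) (fun a b h => (Prod.mk.inj h).1)
    simpa only [Function.comp_def, pow_zero, mul_one] using h

/-- The family of the free generators. -/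
noncomputable def generators (p : ℕ) [Fact p.Prime] (X : Type u) [DecidableEq X] :
    CommutatorFamily p X X where
  elt := FreeGroup.of
  weight _ := 1
  form := FreeAlgebra.ι (ZMod p)
  weight_pos _ := le_rfl
  elt_mem _ := Subgroup.mem_top _
  leading w x := by
    rw [magnus_of, add_sub_cancel_left, wordEval, FreeAlgebra.lift_ι_apply]
    constructor
    · intro i j hij
      rw [wordMatrix, if_neg]
      omega
    · intro i j
      by_cases h : (j : ℕ) = i + 1 <;> simp [wordMatrix, h]
  indep := by
    have h := (FreeAlgebra.basisFreeMonoid (ZMod p) X).linearIndependent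
    have e : (fun l : List X => (l.map (FreeAlgebra.ι (ZMod p))).prod) =
        fun l => FreeAlgebra.basisFreeMonoid (ZMod p) X (FreeMonoid.ofList l) :=
      funext fun l => (basisFreeMonoid_apply_ofList (ZMod p) l).symm
    rw [e]
    exact h

/-- Each factor is written as `1 + (c_i - 1)` and the product is multiplied out. The coefficients do
not depend on `w`. -/
theorem exists_expansion (C : CommutatorFamily p X ι) (L : List ι) :
    ∃ α : List ι →₀ ℤ, α [] = 1 ∧ ∀ w : List X, (magnus ℤ w (L.map C.elt).prod).toMatrix =
      α.sum fun l a => a • (l.map fun i => (magnus ℤ w (C.elt i)).toMatrix - 1).prod := by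
  classical
  induction L with
  | nil =>
    refine ⟨Finsupp.single [] 1, by simp, fun w => ?_⟩
    simp [UT.toMatrix_one]
  | cons i L ih =>
    obtain ⟨α, h1, h2⟩ := ih
    refine ⟨α + α.mapDomain (List.cons i), ?_, fun w => ?_⟩
    · rw [Finsupp.add_apply, h1, Finsupp.mapDomain_of_notMem_range, add_zero]
      simp
    · rw [List.map_cons, List.prod_cons, map_mul, UT.toMatrix_mul, h2 w,
        Finsupp.sum_add_index' (by simp) (by simp [add_smul]),
        Finsupp.sum_mapDomain_index_inj List.cons_injective]
      conv_lhs => rw [← sub_add_cancel (magnus ℤ w (C.elt i)).toMatrix 1, add_mul, one_mul,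
        add_comm]
      congr 1
      rw [Finsupp.mul_sum]
      refine Finsupp.sum_congr fun l _ => ?_
      rw [List.map_cons, List.prod_cons, mul_smul_comm]

/-- In the expansion by monomials in the `c_z - 1` followed by powers of `c - 1`, where `c = C.elt
i₀`, the monomial `c - 1` has coefficient `a`; `dvd_of_combination` applies once the constant term
`1` is removed. -/
theorem dvd_exponent (C : CommutatorFamily p X ι) (i₀ : ι) (n : ℕ) (L : List _) (a : ℕ)
    (h : (L.map (C.elim i₀ n).elt).prod * C.elt i₀ ^ a ∈ magnusKernel X p n) :
    p ^ (n + 1 - C.weight i₀) ∣ a := by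
  classical
  rcases Nat.eq_zero_or_pos a with rfl | ha
  · exact dvd_zero _
  obtain ⟨α, h1, h2⟩ := (C.elim i₀ n).exists_expansion L
  let m : ∀ w : List X, List ({j // j ≠ i₀} × Fin (n + 1)) × ℕ →
      Matrix (Fin (w.length + 1)) (Fin (w.length + 1)) ℤ := fun w q =>
    (q.1.map fun i => (magnus ℤ w ((C.elim i₀ n).elt i)).toMatrix - 1).prod *
      ((magnus ℤ w (C.elt i₀)).toMatrix - 1) ^ q.2
  let β : List ({j // j ≠ i₀} × Fin (n + 1)) × ℕ → ℤ := fun q => α q.1 * (a.choose q.2 : ℤ)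
  have hexp : ∀ w : List X,
      (magnus ℤ w ((L.map (C.elim i₀ n).elt).prod * C.elt i₀ ^ a)).toMatrix =
        ∑ q ∈ α.support ×ˢ Finset.range (a + 1), β q • m w q := by
    intro w
    have hpow : (magnus ℤ w (C.elt i₀)).toMatrix ^ a = ∑ e ∈ Finset.range (a + 1),
        (a.choose e : ℤ) • ((magnus ℤ w (C.elt i₀)).toMatrix - 1) ^ e := by
      conv_lhs => rw [← sub_add_cancel (magnus ℤ w (C.elt i₀)).toMatrix 1]
      rw [(Commute.one_right _).add_pow]
      refine Finset.sum_congr rfl fun e _ => ?_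
      rw [one_pow, mul_one, zsmul_eq_mul, Int.cast_natCast, (Nat.cast_commute _ _).eq]
    rw [map_mul, UT.toMatrix_mul, h2 w, map_pow, UT.toMatrix_pow, hpow, Finset.sum_product,
      Finsupp.sum, Finset.sum_mul]
    refine Finset.sum_congr rfl fun l _ => ?_
    rw [Finset.mul_sum]
    refine Finset.sum_congr rfl fun e _ => ?_
    simp only [β, m]
    rw [smul_mul_smul_comm]
  have hmem0 : (([], 0) : List ({j // j ≠ i₀} × Fin (n + 1)) × ℕ) ∈
      α.support ×ˢ Finset.range (a + 1) := by simp [h1]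
  have key := dvd_of_combination n
    (fun q : List ({j // j ≠ i₀} × Fin (n + 1)) × ℕ =>
      (q.1.map (C.elim i₀ n).weight).sum + q.2 * C.weight i₀) _ (C.indep_elim i₀ n) m
    (fun w q => by
      rw [map_mul, map_pow, map_list_prod, List.map_map]
      exact (IsLeading.list_prod _ _ _ (fun z => (C.elim i₀ n).leading w z) q.1).mul
        ((C.leading w i₀).pow q.2))
    ((α.support ×ˢ Finset.range (a + 1)).erase ([], 0)) β
    (fun w => by
      have := dvd_of_mem_magnusKernel h w 0 (Fin.last _)
      rw [hexp w, ← Finset.add_sum_erase _ _ hmem0] at this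
      have e0 : β ([], 0) • m w ([], 0) = 1 := by simp [β, m, h1]
      rw [e0, add_sub_cancel_left] at this
      simpa only [Matrix.sum_apply, Matrix.smul_apply, smul_eq_mul] using this)
    ([], 1) (by simp [h1, ha])
  simp only [β, h1, List.map_nil, List.sum_nil, one_mul, zero_add, Nat.choose_one_right] at key
  exact_mod_cast key

variable [TopologicalSpace (FreeGroup X)] [IsTopologicalGroup (FreeGroup X)]

theorem mem_lowerPCentral (C : CommutatorFamily p X ι) (i : ι) :
    C.elt i ∈ lowerPCentral p (FreeGroup X) (C.weight i) := by
  have := lowerCentralSeries_le_lowerPCentral p _ (C.elt_mem i)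
  rwa [Nat.sub_add_cancel (C.weight_pos i)] at this

/-- Collection: `c * b = ⁅c, b⁆ * b * c` moves `c` to the right at the cost of a bracket with one
more `c`. Once there are `n + 1` copies of `c`, the bracket has weight above `n` and goes into the
error term `f`. -/
theorem mul_closure_elim (C : CommutatorFamily p X ι) (i₀ : ι) (n : ℕ) {k : FreeGroup X}
    (hk : k ∈ Submonoid.closure (Set.range (C.elim i₀ n).elt)) :
    ∃ k' ∈ Submonoid.closure (Set.range (C.elim i₀ n).elt),
      ∃ f ∈ lowerPCentral p (FreeGroup X) (n + 1), C.elt i₀ * k = k' * C.elt i₀ * f := by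
  induction hk using Submonoid.closure_induction_left with
  | one => exact ⟨1, one_mem _, 1, one_mem _, by simp⟩
  | mul_left x hx y hy ih =>
    obtain ⟨z, rfl⟩ := hx
    obtain ⟨k', hk', f, hf, e⟩ := ih
    set c := C.elt i₀
    set b := (C.elim i₀ n).elt z with hb
    have hbm : b ∈ Submonoid.closure (Set.range (C.elim i₀ n).elt) :=
      Submonoid.subset_closure ⟨z, rfl⟩
    have e2 : c * (b * y) = ⁅c, b⁆ * (b * k' * c) * f := by
      rw [commutatorElement_def]
      simp only [mul_assoc] at e ⊢
      rw [← e]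
      group
    by_cases hz : (z.2 : ℕ) + 1 < n + 1
    · refine ⟨⁅c, b⁆ * (b * k'), mul_mem (Submonoid.subset_closure ⟨(z.1, ⟨z.2 + 1, hz⟩), rfl⟩)
        (mul_mem hbm hk'), f, hf, ?_⟩
      rw [e2]; group
    · have h1 : ⁅c, b⁆ ∈ lowerPCentral p (FreeGroup X) (n + 1) := by
        have h2 := iterBracket_mem_lowerCentralSeries (C.weight_pos i₀) (C.weight_pos z.1)
          (C.elt_mem i₀) (C.elt_mem z.1) (z.2 + 1)
        have h3 := lowerCentralSeries_le_lowerPCentral p _ h2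
        refine lowerPCentral_antitone (by omega) ?_ h3
        have := C.weight_pos z.1
        have := Nat.mul_le_mul (by omega : n + 1 ≤ (z.2 : ℕ) + 1) (C.weight_pos i₀)
        omega
      refine ⟨b * k', mul_mem hbm hk', (b * k' * c)⁻¹ * ⁅c, b⁆ * (b * k' * c) * f,
        mul_mem ?_ hf, ?_⟩
      · have := (lowerPCentral_normal p (FreeGroup X) (n + 1)).conj_mem _ h1 (b * k' * c)⁻¹
        rwa [inv_inv] at this
      · rw [e2]; group

theorem exists_decomposition (C : CommutatorFamily p X ι) (i₀ : ι) (n : ℕ) {g : FreeGroup X}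
    (hg : g ∈ Submonoid.closure (Set.range C.elt)) :
    ∃ k ∈ Submonoid.closure (Set.range (C.elim i₀ n).elt), ∃ a : ℕ,
      ∃ f ∈ lowerPCentral p (FreeGroup X) (n + 1), g = k * C.elt i₀ ^ a * f := by
  induction hg using Submonoid.closure_induction_left with
  | one => exact ⟨1, one_mem _, 0, 1, one_mem _, by simp⟩
  | mul_left x hx y hy ih =>
    obtain ⟨i, rfl⟩ := hx
    obtain ⟨k, hk, a, f, hf, rfl⟩ := ih
    by_cases hi : i = i₀
    · subst hi
      obtain ⟨k', hk', f', hf', e⟩ := C.mul_closure_elim i n hk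
      refine ⟨k', hk', a + 1, (C.elt i ^ a)⁻¹ * f' * C.elt i ^ a * f, mul_mem ?_ hf, ?_⟩
      · have := (lowerPCentral_normal p (FreeGroup X) (n + 1)).conj_mem _ hf' (C.elt i ^ a)⁻¹
        rwa [inv_inv] at this
      · calc C.elt i * (k * C.elt i ^ a * f) = (C.elt i * k) * C.elt i ^ a * f := by group
          _ = k' * C.elt i * f' * C.elt i ^ a * f := by rw [e]
          _ = _ := by rw [pow_succ']; group
    · exact ⟨C.elt i * k, mul_mem (Submonoid.subset_closure ⟨(⟨i, hi⟩, 0), rfl⟩) hk, a, f, hf,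
        by group⟩

/-- Double induction, on `m = n + 1 - e` and on the number of members of least weight `e`. After
eliminating `i₀`, the members of weight `e` are those old ones with `j ≠ i₀` and no bracket, one
fewer than before. At `e = n + 1` every member lies in `F^(n+1,p)`. -/
theorem closure_inf_magnusKernel_le [DiscreteTopology (FreeGroup X)] (n m : ℕ) :
    ∀ e, e + m = n + 1 → ∀ (q : ℕ) (ι : Type u) [Finite ι] (C : CommutatorFamily p X ι),
      (∀ i, e ≤ C.weight i) → Nat.card {i // C.weight i = e} ≤ q →
      ∀ g ∈ Submonoid.closure (Set.range C.elt), g ∈ magnusKernel X p n →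
        g ∈ lowerPCentral p (FreeGroup X) (n + 1) := by
  induction m with
  | zero =>
    intro e he q ι _ C hC _ g hg _
    have : Submonoid.closure (Set.range C.elt) ≤ (lowerPCentral p (FreeGroup X) (n + 1)).toSubmonoid := by
      rw [Submonoid.closure_le]
      rintro _ ⟨i, rfl⟩
      exact lowerPCentral_antitone (by omega) (by have := hC i; omega) (C.mem_lowerPCentral i)
    exact this hg
  | succ m ihm =>
    intro e he q
    induction q with
    | zero =>
      intro ι _ C hC hq
      have hempty : IsEmpty {i // C.weight i = e} := by
        rcases Nat.card_eq_zero.1 (Nat.le_zero.1 hq) with h | h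
        · exact h
        · exact absurd (inferInstance : Finite {i // C.weight i = e}) h.not_finite
      refine ihm (e + 1) (by omega) _ ι C (fun i => ?_) le_rfl
      exact lt_of_le_of_ne (hC i) (fun h => hempty.false ⟨i, h.symm⟩)
    | succ q ihq =>
      intro ι _ C hC hq g hg hgT
      by_cases hex : ∃ i₀, C.weight i₀ = e
      · obtain ⟨i₀, hi₀⟩ := hex
        obtain ⟨k, hk, a, f, hf, rfl⟩ := C.exists_decomposition i₀ n hg
        have hle := lowerPCentral_le_magnusKernel (X := X) p n
        have hkT : k * C.elt i₀ ^ a ∈ magnusKernel X p n :=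
          (Subgroup.mul_mem_cancel_right _ (hle hf)).1 hgT
        have hdvd : p ^ (n + 1 - C.weight i₀) ∣ a := by
          obtain ⟨L, hL, rfl⟩ := Submonoid.exists_list_of_mem_closure hk
          obtain ⟨L', rfl⟩ : ∃ L', List.map (C.elim i₀ n).elt L' = L := by
            rw [← Set.mem_range, Set.range_list_map]
            exact hL
          exact C.dvd_exponent i₀ n L' a hkT
        have hpow : C.elt i₀ ^ a ∈ lowerPCentral p (FreeGroup X) (n + 1) := by
          obtain ⟨b, rfl⟩ := hdvd
          rw [pow_mul]
          refine pow_mem (lowerPCentral_antitone (by omega) ?_ (pow_pow_mem_lowerPCentral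
            (C.weight_pos i₀) (C.mem_lowerPCentral i₀) _)) b
          omega
        refine mul_mem (mul_mem ?_ hpow) hf
        refine ihq _ (C.elim i₀ n) (fun z => (hC z.1).trans (Nat.le_add_right _ _)) ?_ k hk
          ((Subgroup.mul_mem_cancel_right _ (hle hpow)).1 hkT)
        have hlt : Nat.card {z // (C.elim i₀ n).weight z = e} < Nat.card {i // C.weight i = e} := by
          have hz : ∀ z : {z // (C.elim i₀ n).weight z = e},
              C.weight z.1.1 = e ∧ z.1.2 = 0 := by
            rintro ⟨⟨j, t⟩, h⟩
            have h' : C.weight j + t * C.weight i₀ = e := h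
            have h1 := hC j
            have h2 := C.weight_pos i₀
            have h3 : (t : ℕ) * C.weight i₀ = 0 := by omega
            have h4 : (t : ℕ) = 0 := by
              rcases Nat.mul_eq_zero.1 h3 with h | h
              · exact h
              · omega
            exact ⟨by simp only; omega, Fin.ext h4⟩
          have := Fintype.ofFinite {z // (C.elim i₀ n).weight z = e}
          have := Fintype.ofFinite {i // C.weight i = e}
          rw [Nat.card_eq_fintype_card, Nat.card_eq_fintype_card]
          refine Fintype.card_lt_of_injective_of_notMem
            (f := fun z => (⟨z.1.1, (hz z).1⟩ : {i // C.weight i = e})) ?_ (b := ⟨i₀, hi₀⟩) ?_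
          · intro y z hyz
            have h1 := congrArg (fun i => i.1) hyz
            exact Subtype.ext (Prod.ext (Subtype.ext h1) ((hz y).2.trans (hz z).2.symm))
          · rintro ⟨z, hz'⟩
            exact z.1.1.2 (congrArg (fun i => i.1) hz')
        omega
      · refine ihm (e + 1) (by omega) _ ι C (fun i => ?_) le_rfl g hg hgT
        exact lt_of_le_of_ne (hC i) (fun h => hex ⟨i, h.symm⟩)

end CommutatorFamily

/-- In a free group of finite rank, the lower `p`-central filtration is the filtration by the powers of the
ideal generated by `p` and the augmentation ideal, expressed by Magnus coefficients. -/
theorem magnusKernel_eq_lowerPCentral [Finite X] [TopologicalSpace (FreeGroup X)]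
    [IsTopologicalGroup (FreeGroup X)] [DiscreteTopology (FreeGroup X)] (p n : ℕ) [Fact p.Prime] :
    magnusKernel X p n = lowerPCentral p (FreeGroup X) (n + 1) := by
  have hle := lowerPCentral_le_magnusKernel (X := X) p n
  refine le_antisymm (fun g hg => ?_) hle
  have hp : 1 ≤ p ^ n := Nat.one_le_pow _ _ (Fact.out : p.Prime).pos
  have hpos : ∃ k ∈ Submonoid.closure (Set.range (CommutatorFamily.generators p X).elt),
      ∃ f ∈ lowerPCentral p (FreeGroup X) (n + 1), g = k * f := by
    clear hg
    have hof : ∀ x : X, FreeGroup.of x ∈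
        Submonoid.closure (Set.range (CommutatorFamily.generators p X).elt) :=
      fun x => Submonoid.subset_closure ⟨x, rfl⟩
    induction g using FreeGroup.induction_on with
    | C1 => exact ⟨1, one_mem _, 1, one_mem _, by simp⟩
    | of x => exact ⟨_, hof x, 1, one_mem _, by simp⟩
    | inv_of x _ =>
      -- Inverses become positive words because `x ^ p ^ n` lies in `F^(n+1,p)`.
      refine ⟨FreeGroup.of x ^ (p ^ n - 1), pow_mem (hof x) _, (FreeGroup.of x ^ p ^ n)⁻¹,
        inv_mem ?_, ?_⟩
      · have := pow_pow_mem_lowerPCentral (p := p) (n := 1) le_rfl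
          (Subgroup.mem_top (FreeGroup.of x)) n
        rwa [add_comm] at this
      · conv_rhs => rw [← Nat.sub_add_cancel hp, Nat.add_sub_cancel, pow_succ, mul_inv_rev]
        group
    | mul g h hg hh =>
      obtain ⟨k, hk, f, hf, rfl⟩ := hg
      obtain ⟨k', hk', f', hf', rfl⟩ := hh
      refine ⟨k * k', mul_mem hk hk', k'⁻¹ * f * k' * f', mul_mem ?_ hf', by group⟩
      have := (lowerPCentral_normal p (FreeGroup X) (n + 1)).conj_mem _ hf k'⁻¹
      rwa [inv_inv] at this
  obtain ⟨k, hk, f, hf, rfl⟩ := hpos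
  exact mul_mem (CommutatorFamily.closure_inf_magnusKernel_le n n 1 (add_comm _ _) _ X
    (CommutatorFamily.generators p X) (fun _ => le_rfl) le_rfl k hk
    ((Subgroup.mul_mem_cancel_right _ (hle hf)).1 hg)) hf

end MagnusKernel

/-! ### Composition and descent of continuous homomorphisms -/

section ContinuousHoms

variable {G A B : Type*} [Group G] [TopologicalSpace G] [Group A] [TopologicalSpace A] [Group B]
  [TopologicalSpace B]

/-- The composition of a continuous homomorphism to a discrete group with any homomorphism. -/
def ContinuousMonoidHom.compDiscrete [DiscreteTopology A] (f : A →* B) (ρ : G →ₜ* A) : G →ₜ* B :=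
  ⟨f.comp ρ.toMonoidHom, (continuous_of_discreteTopology (f := f)).comp ρ.continuous_toFun⟩

/-- The continuous homomorphism on a quotient group induced by one that is trivial on the kernel. -/
def ContinuousMonoidHom.quotientLift (K : Subgroup G) [K.Normal] (ρ : G →ₜ* A)
    (h : ∀ x ∈ K, ρ x = 1) : G ⧸ K →ₜ* A :=
  ⟨QuotientGroup.lift K ρ.toMonoidHom h, ρ.continuous_toFun.quotient_lift _⟩

end ContinuousHoms

/-! ### Comparison of `T`, `T̄` and the lower `p`-central filtration -/

section KernelIntersections

variable {p n : ℕ} {G : Type u} [Group G] [TopologicalSpace G]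

theorem mem_TSub_iff {x : G} : x ∈ TSub p n G ↔
    ∀ s e, 1 ≤ s → 1 ≤ e → s + e = n + 1 → ∀ ρ : G →ₜ* UT s (ZMod (p ^ e)), ρ x = 1 := by
  simp only [TSub, kernelIntersection, Subgroup.mem_iInf]
  constructor
  · intro h s e hs he hse ρ
    obtain ⟨k, rfl⟩ := Nat.exists_eq_add_of_le' hs
    obtain rfl : e = n - (k + 1) + 1 := by omega
    exact h ⟨k, by omega⟩ ρ
  · intro h k ρ
    exact h _ _ (by omega) (by omega) (by omega) ρ

theorem mem_TBarSub_iff {x : G} : x ∈ TBarSub p n G ↔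
    ∀ k m, k + 1 + m = n → ∀ ρ : G →ₜ* UTBar p (k + 1) m, ρ x = 1 := by
  simp only [TBarSub, kernelIntersection, Subgroup.mem_iInf]
  constructor
  · intro h k m hkm ρ
    obtain rfl : m = n - (k + 1) := by omega
    exact h ⟨k, by omega⟩ ρ
  · intro h k ρ
    exact h _ _ (by omega) ρ

theorem lowerPCentral_le_TSub [IsTopologicalGroup G] : lowerPCentral p G (n + 1) ≤ TSub p n G := by
  intro x hx
  rw [mem_TSub_iff]
  intro s e _ _ h ρ
  exact map_eq_one_of_mem_lowerPCentral h.le ρ.toMonoidHom ρ.continuous_toFun hx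

theorem TSub_succ_le : TSub p (n + 1) G ≤ TSub p n G := by
  intro x hx
  rw [mem_TSub_iff] at hx ⊢
  intro s e hs he h ρ
  have := hx (s + 1) e (by omega) he (by omega)
    (ρ.compDiscrete UT.extend)
  exact UT.extend_injective (this.trans (map_one _).symm)

/-- The block embedding `U_s(ℤ/p^(m+1)) → U_{s+1}(ℤ/p^(m+1))` stays injective after passing to `Ū`,
and raises the stage `s + m` by one. -/
theorem TBarSub_succ_le : TBarSub p (n + 1) G ≤ TSub p n G := by
  intro x hx
  rw [mem_TBarSub_iff] at hx
  rw [mem_TSub_iff]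
  intro s e hs he h ρ
  obtain ⟨m, rfl⟩ := Nat.exists_eq_add_of_le' he
  have := hx s m (by omega) (ρ.compDiscrete
    ((QuotientGroup.mk' (omegaInl p (s + 1) m).range).comp UT.extend))
  exact UT.extend_eq_one_of_mem_range p m _ ((QuotientGroup.eq_one_iff _).1 this)

/-- A continuous homomorphism to `Ū` is trivial on `G^(n,p)`. -/
theorem mk_comp_lowerPCentral [IsTopologicalGroup G] {s m : ℕ} [NeZero s] (h : s + m = n) (hs : 1 ≤ n)
    (ρ : G →ₜ* UTBar p s m) {x : G} (hx : x ∈ lowerPCentral p G n) : ρ x = 1 := by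
  -- A lift of `ρ` to `U` need not exist, so the filtration used is the image in `Ū` of the level
  -- filtration.
  have h1 := lowerPCentral_le_of_filtration (p := p)
    (fun i => ((levelSubgroup p s (ZMod (p ^ (m + 1))) i).map
      (QuotientGroup.mk' (omegaInl p s m).range)).comap ρ.toMonoidHom) (by
        rw [levelSubgroup_one, ← MonoidHom.range_eq_map,
          MonoidHom.range_eq_top.2 (QuotientGroup.mk'_surjective _), Subgroup.comap_top])
    (fun i => (isClosed_discrete (((levelSubgroup p s (ZMod (p ^ (m + 1))) i).map
      (QuotientGroup.mk' (omegaInl p s m).range) : Subgroup (UTBar p s m)) :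
        Set (UTBar p s m))).preimage ρ.continuous_toFun) (by
      rintro i _ x ⟨M, hM, hMx⟩
      exact ⟨M ^ p, pow_mem_levelSubgroup hM, by rw [map_pow, map_pow, hMx]⟩) (by
      rintro i _ g x ⟨M, hM, hMx⟩
      obtain ⟨L, hL⟩ := QuotientGroup.mk'_surjective (omegaInl p s m).range (ρ.toMonoidHom g)
      exact ⟨⁅L, M⁆, commutator_mem_levelSubgroup L hM, by
        rw [map_commutatorElement, map_commutatorElement, hMx, hL]⟩) n hs hx
  obtain ⟨M, hM, hMx⟩ := h1
  refine hMx.symm.trans ((QuotientGroup.eq_one_iff _).2 ?_)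
  exact mem_range_omegaInl_of_mem_levelSubgroup h hM

theorem lowerPCentral_le_TBarSub [IsTopologicalGroup G] :
    lowerPCentral p G n ≤ TBarSub p n G := by
  intro x hx
  rw [mem_TBarSub_iff]
  intro k m h ρ
  exact mk_comp_lowerPCentral h (by omega) ρ hx

end KernelIntersections

/-! ### Free profinite groups and their quotients -/

section Free

instance UT.finite (s : ℕ) (R : Type) [CommRing R] [Finite R] : Finite (UT s R) :=
  Finite.of_injective _ UT.toMatrix_injective

/-- Words longer than `n` have coefficient ring `ZMod 1` and impose nothing; finitely many words
remain, each with a finite target group. -/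
theorem magnusKernel_finiteIndex (X : Type u) [DecidableEq X] [Finite X] (p n : ℕ) [Fact p.Prime] :
    (magnusKernel X p n).FiniteIndex := by
  have hp := (Fact.out : p.Prime).ne_zero
  have h : magnusKernel X p n = ⨅ w : {w : List X // w.length ≤ n},
      (magnus (ZMod (p ^ (n + 1 - w.1.length))) w.1).ker := by
    refine le_antisymm (le_iInf fun w => iInf_le _ w.1) (le_iInf fun w => ?_)
    by_cases hw : w.length ≤ n
    · exact iInf_le (fun w : {w : List X // w.length ≤ n} =>
        (magnus (ZMod (p ^ (n + 1 - w.1.length))) w.1).ker) ⟨w, hw⟩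
    · have : Subsingleton (ZMod (p ^ (n + 1 - w.length))) := by
        rw [show n + 1 - w.length = 0 by omega, pow_zero]
        exact inferInstanceAs (Subsingleton (ZMod 1))
      intro g _
      exact UT.toMatrix_injective (Subsingleton.elim _ _)
  rw [h]
  have : Finite {w : List X // w.length ≤ n} := (List.finite_length_le X n).to_subtype
  have hk : ∀ w : {w : List X // w.length ≤ n},
      (magnus (ZMod (p ^ (n + 1 - w.1.length))) w.1).ker.FiniteIndex := by
    intro w
    have : NeZero (p ^ (n + 1 - w.1.length)) := ⟨pow_ne_zero _ hp⟩
    have := UT.finite w.1.length (ZMod (p ^ (n + 1 - w.1.length)))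
    infer_instance
  exact Subgroup.finiteIndex_iInf hk

theorem exists_open_normal_not_mem_sup {S : Type u} [Group S] [TopologicalSpace S]
    [IsTopologicalGroup S] (hS : ∀ U : Set S, IsOpen U → (1 : S) ∈ U →
      ∃ M : Subgroup S, M.Normal ∧ IsOpen (M : Set S) ∧ (M : Set S) ⊆ U)
    {C : Subgroup S} (hC : IsClosed (C : Set S)) {σ : S} (hσ : σ ∉ C) :
    ∃ M : Subgroup S, M.Normal ∧ IsOpen (M : Set S) ∧ σ ∉ C ⊔ M := by
  obtain ⟨M, hMn, hMo, hM⟩ := hS {g | σ * g ∈ (C : Set S)ᶜ}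
    (hC.isOpen_compl.preimage (continuous_const_mul σ)) (by simpa using hσ)
  refine ⟨M, hMn, hMo, fun h => ?_⟩
  obtain ⟨c, hc, m, hm, rfl⟩ := Subgroup.mem_sup_of_normal_right.1 h
  have := hM (inv_mem hm)
  simp only [Set.mem_ofPred_eq, mul_inv_cancel_right] at this
  exact this hc

theorem exists_open_normal_of_profinite {S : Type u} [Group S] [TopologicalSpace S]
    [IsTopologicalGroup S] [CompactSpace S] [TotallyDisconnectedSpace S] (U : Set S)
    (hU : IsOpen U) (h1 : (1 : S) ∈ U) :
    ∃ M : Subgroup S, M.Normal ∧ IsOpen (M : Set S) ∧ (M : Set S) ⊆ U := by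
  have : T1Space S := ⟨fun x => by
    rw [← totallyDisconnectedSpace_iff_connectedComponent_singleton.1 inferInstance x]
    exact isClosed_connectedComponent⟩
  obtain ⟨M, hM⟩ := ProfiniteGrp.exist_openNormalSubgroup_sub_open_nhds_of_one hU h1
  exact ⟨M.toSubgroup, M.isNormal', M.isOpen', hM⟩

/-- In a free profinite group, `T_n(S)` is contained in `S^(n+1,p)`. -/
theorem TSub_le_lowerPCentral_of_isFreeProfinite (p n : ℕ) [Fact p.Prime] {S : Type u} [Group S]
    [TopologicalSpace S] [IsTopologicalGroup S] [CompactSpace S] [TotallyDisconnectedSpace S]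
    (hS : IsFreeProfinite S) : TSub p n S ≤ lowerPCentral p S (n + 1) := by
  classical
  intro σ hσ
  by_contra hσC
  obtain ⟨B, hB1, hB2⟩ := hS
  obtain ⟨M, hMn, hMo, hM⟩ := exists_open_normal_not_mem_sup exists_open_normal_of_profinite
    (isClosed_lowerPCentral (p := p) (n + 1)) hσC
  set W := lowerPCentral p S (n + 1) ⊔ M with hW
  have hWo : IsOpen (W : Set S) := Subgroup.isOpen_mono le_sup_right hMo
  have hWd : DiscreteTopology (S ⧸ W) := QuotientGroup.discreteTopology hWo
  -- The basis converges to `1`, so only finitely many of its elements lie outside the open subgroup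
  -- `W`.
  let X : Type u := {b : B // (b : S) ∉ W}
  have hX : Finite X := hB1 (hWo.mem_nhds W.one_mem)
  let _ : TopologicalSpace (FreeGroup X) := ⊥
  have : DiscreteTopology (FreeGroup X) := ⟨rfl⟩
  set N := lowerPCentral p (FreeGroup X) (n + 1) with hN
  have hNker := magnusKernel_eq_lowerPCentral (X := X) p n
  have hNfin : N.FiniteIndex := by
    rw [hN, ← hNker]
    exact magnusKernel_finiteIndex X p n
  have hQfin : Finite (FreeGroup X ⧸ N) := Subgroup.finite_quotient_of_finiteIndex
  have hQd : DiscreteTopology (FreeGroup X ⧸ N) := QuotientGroup.discreteTopology (isOpen_discrete _)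
  let ψ : FreeGroup X →* S ⧸ W := FreeGroup.lift fun x => QuotientGroup.mk' W (x.1 : S)
  have hψ : N ≤ ψ.ker := by
    have h := lowerPCentral_le_of_filtration (p := p)
      (fun i => ((lowerPCentral p S i).map (QuotientGroup.mk' W)).comap ψ) (by
        rw [lowerPCentral_one, ← MonoidHom.range_eq_map,
          MonoidHom.range_eq_top.2 (QuotientGroup.mk'_surjective _), Subgroup.comap_top])
      (fun i => isClosed_discrete _) (by
        rintro i hi x ⟨s, hs, hsx⟩
        exact ⟨s ^ p, pow_mem_lowerPCentral hi hs, by rw [map_pow, map_pow, hsx]⟩) (by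
        rintro i hi g x ⟨s, hs, hsx⟩
        obtain ⟨t, ht⟩ := QuotientGroup.mk'_surjective W (ψ g)
        exact ⟨⁅t, s⁆, commutator_mem_lowerPCentral hi t hs, by
          rw [map_commutatorElement, map_commutatorElement, hsx, ht]⟩) (n + 1) (by omega)
    intro w hw
    obtain ⟨s, hs, hsw⟩ := h hw
    rw [MonoidHom.mem_ker, ← hsw]
    exact (QuotientGroup.eq_one_iff _).2 (le_sup_left (a := lowerPCentral p S (n + 1)) hs)
  -- Freeness of `S` provides a map to the finite group `FreeGroup X ⧸ N` that lifts `S → S ⧸ W`.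
  let f : B → FreeGroup X ⧸ N := fun b =>
    if h : (b : S) ∉ W then QuotientGroup.mk' N (FreeGroup.of (⟨b, h⟩ : X)) else 1
  have hf : Tendsto f cofinite (𝓝 1) := by
    refine tendsto_nhds_of_eventually_eq ?_
    filter_upwards [hB1 (hWo.mem_nhds W.one_mem)] with b hb
    exact dif_neg (not_not.2 hb)
  obtain ⟨φ, hφ, -⟩ := hB2 (FreeGroup X ⧸ N) f hf
  let q : S →ₜ* S ⧸ W := ⟨QuotientGroup.mk' W, QuotientGroup.continuous_mk⟩
  let χ : S →ₜ* S ⧸ W := φ.compDiscrete (QuotientGroup.lift N ψ hψ)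
  -- Both maps agree on the basis. Since `σ ∉ W`, its image in `FreeGroup X ⧸ N` is nontrivial,
  -- while every Magnus representation there pulls back to one of `S` and so kills `σ`.
  have hχ : χ = q := by
    refine (hB2 (S ⧸ W) (fun b => q b) ?_).unique (fun b => ?_) (fun b => rfl)
    · have := (q.continuous_toFun.tendsto 1).comp hB1
      simpa [Function.comp_def] using this
    · change QuotientGroup.lift N ψ hψ (φ b) = QuotientGroup.mk' W (b : S)
      rw [hφ]
      by_cases hb : (b : S) ∉ W
      · simp only [f, dif_pos hb]
        exact FreeGroup.lift_apply_of
      · simp only [f, dif_neg hb, map_one]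
        exact ((QuotientGroup.eq_one_iff _).2 (not_not.1 hb)).symm
  obtain ⟨w, hw⟩ := QuotientGroup.mk'_surjective N (φ σ)
  have hwN : w ∉ N := by
    intro hwN
    have h1 : φ σ = 1 := hw.symm.trans ((QuotientGroup.eq_one_iff _).2 hwN)
    have h2 : χ σ = 1 := by
      change QuotientGroup.lift N ψ hψ (φ σ) = 1
      rw [h1, map_one]
    rw [hχ] at h2
    exact hM ((QuotientGroup.eq_one_iff _).1 h2)
  apply hwN
  rw [hN, ← hNker, magnusKernel, Subgroup.mem_iInf]
  intro u
  by_cases hu : 1 ≤ u.length ∧ u.length ≤ n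
  · have hker : N ≤ (magnus (ZMod (p ^ (n + 1 - u.length))) u).ker := by
      rw [hN, ← hNker]
      exact iInf_le _ u
    have := mem_TSub_iff.1 hσ u.length (n + 1 - u.length) hu.1 (by omega) (by omega)
      (φ.compDiscrete (QuotientGroup.lift N _ hker))
    have h2 : QuotientGroup.lift N _ hker (φ σ) = 1 := this
    rw [← hw] at h2
    exact h2
  · have hsub : ∀ a b : UT u.length (ZMod (p ^ (n + 1 - u.length))), a = b := by
      intro a b
      rcases Nat.lt_or_ge n u.length with h | h
      · have : Subsingleton (ZMod (p ^ (n + 1 - u.length))) := by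
          rw [show n + 1 - u.length = 0 by omega, pow_zero]
          exact inferInstanceAs (Subsingleton (ZMod 1))
        exact UT.toMatrix_injective (Subsingleton.elim _ _)
      · have h0 : u.length = 0 := by omega
        have : Subsingleton (Fin (u.length + 1)) := by
          rw [h0]
          exact inferInstanceAs (Subsingleton (Fin 1))
        apply UT.toMatrix_injective
        ext i j
        rw [Subsingleton.elim j i, UT.toMatrix_diag, UT.toMatrix_diag]
    exact hsub _ _

/-- The relevant representations of `S` kill `S^(n+1,p)`, hence `N`, and so factor through `S ⧸ N`.
-/
theorem TSub_quotient_le {p n : ℕ} {S : Type u} [Group S] [TopologicalSpace S]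
    [IsTopologicalGroup S] (h : TSub p n S ≤ lowerPCentral p S (n + 1)) (N : Subgroup S) [N.Normal]
    (hN : N ≤ lowerPCentral p S (n + 1)) :
    TSub p n (S ⧸ N) ≤ lowerPCentral p (S ⧸ N) (n + 1) := by
  intro x hx
  obtain ⟨σ, rfl⟩ := QuotientGroup.mk'_surjective N x
  refine lowerPCentral_le_comap (QuotientGroup.mk' N) QuotientGroup.continuous_mk (by omega)
    (h (mem_TSub_iff.2 fun s e hs he hse ρ => ?_))
  exact mem_TSub_iff.1 hx s e hs he hse (ρ.quotientLift N fun y hy =>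
    map_eq_one_of_mem_lowerPCentral hse.le ρ.toMonoidHom ρ.continuous_toFun (hN hy))

theorem exists_open_normal_quotient {S : Type u} [Group S] [TopologicalSpace S]
    [IsTopologicalGroup S] (h : ∀ U : Set S, IsOpen U → (1 : S) ∈ U →
      ∃ M : Subgroup S, M.Normal ∧ IsOpen (M : Set S) ∧ (M : Set S) ⊆ U) (N : Subgroup S) [N.Normal]
    (U : Set (S ⧸ N)) (hU : IsOpen U) (h1 : (1 : S ⧸ N) ∈ U) :
    ∃ M : Subgroup (S ⧸ N), M.Normal ∧ IsOpen (M : Set (S ⧸ N)) ∧ (M : Set (S ⧸ N)) ⊆ U := by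
  obtain ⟨M, hMn, hMo, hM⟩ := h (QuotientGroup.mk' N ⁻¹' U)
    (hU.preimage QuotientGroup.continuous_mk) (by simpa using h1)
  refine ⟨M.map (QuotientGroup.mk' N), hMn.map _ (QuotientGroup.mk'_surjective N), ?_, ?_⟩
  · exact QuotientGroup.isOpenMap_coe _ hMo
  · rintro _ ⟨x, hx, rfl⟩
    exact hM hx

end Free

/-! ### Restriction of cochains to a subgroup -/

section NormalizedRestriction

variable {G : Type u} [Group G] [TopologicalSpace G]

/-- The function `k ↦ g k - g 1` on `K`. -/
def normalizedRestriction (K : Subgroup G) (p : ℕ) : C(G, ZMod p) →+ (K → ZMod p) where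
  toFun g k := g k - g 1
  map_zero' := by ext; simp
  map_add' g h := by ext; simp; ring

theorem normalizedRestriction_apply {p : ℕ} {K : Subgroup G} (g : C(G, ZMod p)) (k : K) :
    normalizedRestriction K p g k = g k - g 1 := rfl

end NormalizedRestriction

/-! ### The kernel of inflation as homomorphisms on `K` -/

section Transgression

variable {p : ℕ} {G : Type u} [Group G] [TopologicalSpace G] [IsTopologicalGroup G]
  (K : Subgroup G) [K.Normal]

/-- The pairs of a class in `H²(G/K)` and a continuous cochain `g` of `G` such that the inflation of a
cocycle in the class is the coboundary of `g`. The class is the transgression of the homomorphism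
`k ↦ g k - g 1` on `K`. -/
def transgression (p : ℕ) : AddSubgroup (H2 p (G ⧸ K) × C(G, ZMod p)) where
  carrier := {q | ∃ f : contCocycles₂ p (G ⧸ K), QuotientAddGroup.mk f = q.1 ∧
    ∀ x y : G, f.1 ((x : G ⧸ K), (y : G ⧸ K)) = q.2 y - q.2 (x * y) + q.2 x}
  zero_mem' := ⟨0, rfl, fun x y => by simp⟩
  add_mem' := by
    rintro ⟨c, g⟩ ⟨c', g'⟩ ⟨f, h1, h2⟩ ⟨f', h1', h2'⟩
    refine ⟨f + f', by rw [QuotientAddGroup.mk_add, h1, h1']; rfl, fun x y => ?_⟩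
    have e1 := h2 x y
    have e2 := h2' x y
    simp only [AddSubgroup.coe_add, ContinuousMap.add_apply, Prod.snd_add] at *
    rw [e1, e2]
    ring
  neg_mem' := by
    rintro ⟨c, g⟩ ⟨f, h1, h2⟩
    refine ⟨-f, by rw [QuotientAddGroup.mk_neg, h1]; rfl, fun x y => ?_⟩
    have e1 := h2 x y
    simp only [AddSubgroup.coe_neg, ContinuousMap.neg_apply, Prod.snd_neg] at *
    rw [e1]
    ring

variable {K}

theorem mem_ker_inflation_iff {c : H2 p (G ⧸ K)} :
    c ∈ (H2.inflation p K).ker ↔ ∃ g, (c, g) ∈ transgression K p := by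
  constructor
  · induction c using QuotientAddGroup.induction_on with
    | H f =>
      intro h
      have h' : ((contCocycles₂.pullback p ⟨QuotientGroup.mk' K, QuotientGroup.continuous_mk⟩ f :
          contCocycles₂ p G) : H2 p G) = 0 := h
      rw [QuotientAddGroup.eq_zero_iff] at h'
      obtain ⟨g, hg⟩ := h'
      exact ⟨g, f, rfl, fun x y => (DFunLike.congr_fun hg (x, y)).symm⟩
  · rintro ⟨g, f, rfl, h⟩
    change ((contCocycles₂.pullback p ⟨QuotientGroup.mk' K, QuotientGroup.continuous_mk⟩ f :
          contCocycles₂ p G) : H2 p G) = 0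
    rw [QuotientAddGroup.eq_zero_iff]
    refine ⟨g, ?_⟩
    ext ⟨x, y⟩
    exact (h x y).symm

section

variable {c : H2 p (G ⧸ K)} {g : C(G, ZMod p)}

/-- The cocycle identity gives `f (x, 1) = f (1, 1)`; the coboundary equations at `(x, k)` and `(1,
1)` are then compared. -/
theorem transgression_mul_right (h : (c, g) ∈ transgression K p) (x : G) {k : G} (hk : k ∈ K) :
    g (x * k) = g x + g k - g 1 := by
  obtain ⟨f, -, h⟩ := h
  have h1 := f.2 (x : G ⧸ K) 1 1
  have h2 := h x k
  have h3 := h 1 1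
  rw [(QuotientGroup.eq_one_iff k).2 hk] at h2
  simp only [QuotientGroup.mk_one, mul_one] at h1 h2 h3
  linear_combination h2 - h3 + h1

theorem transgression_mul_left (h : (c, g) ∈ transgression K p) (x : G) {k : G} (hk : k ∈ K) :
    g (k * x) = g x + g k - g 1 := by
  obtain ⟨f, -, h⟩ := h
  have h1 := f.2 1 1 (x : G ⧸ K)
  have h2 := h k x
  have h3 := h 1 1
  rw [(QuotientGroup.eq_one_iff k).2 hk] at h2
  simp only [QuotientGroup.mk_one, mul_one, one_mul] at h1 h2 h3
  linear_combination h2 - h3 - h1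

theorem normalizedRestriction_mul (h : (c, g) ∈ transgression K p) (x y : K) :
    normalizedRestriction K p g (x * y) =
      normalizedRestriction K p g x + normalizedRestriction K p g y := by
  simp only [normalizedRestriction_apply, Subgroup.coe_mul]
  rw [transgression_mul_right h _ y.2]
  ring

theorem pow_apply_of_mul_right (h : (c, g) ∈ transgression K p) {k : G} (hk : k ∈ K) (m : ℕ) :
    g (k ^ m) = g 1 + m * (g k - g 1) := by
  induction m with
  | zero => simp
  | succ m ih =>
    rw [pow_succ, transgression_mul_right h _ hk, ih]
    push_cast
    ring

/-- On `K`, `g - g 1` is a homomorphism to a group of exponent `p` that is invariant under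
conjugation by `G`, so it kills `p`-th powers and `[G, K]`. -/
theorem apply_of_mem_lowerPCentral_succ {n : ℕ} (hn : 1 ≤ n) (hK : K = lowerPCentral p G n)
    (h : (c, g) ∈ transgression K p) {x : G} (hx : x ∈ lowerPCentral p G (n + 1)) :
    g x = g 1 := by
  let H : Subgroup G :=
    { carrier := {x | x ∈ K ∧ g x = g 1}
      one_mem' := ⟨K.one_mem, rfl⟩
      mul_mem' := by
        rintro x y ⟨hx, ex⟩ ⟨hy, ey⟩
        exact ⟨mul_mem hx hy, by rw [transgression_mul_right h _ hy, ex, ey]; ring⟩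
      inv_mem' := by
        rintro x ⟨hx, ex⟩
        refine ⟨inv_mem hx, ?_⟩
        have := transgression_mul_right h x (inv_mem hx)
        rw [mul_inv_cancel, ex] at this
        linear_combination -this }
  have hle : lowerPCentral p G (n + 1) ≤ H := by
    refine lowerPCentral_succ_le hn ?_ ?_ ?_
    · have h1 : IsClosed (K : Set G) := hK ▸ isClosed_lowerPCentral n
      exact h1.inter (isClosed_eq g.continuous continuous_const)
    · rintro x hx
      rw [← hK] at hx
      refine ⟨pow_mem hx p, ?_⟩
      rw [pow_apply_of_mul_right h hx, CharP.cast_eq_zero, zero_mul, add_zero]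
    · rintro y x hx
      rw [← hK] at hx
      have h1 : y * x * y⁻¹ ∈ K := ‹K.Normal›.conj_mem x hx y
      refine ⟨mul_mem h1 (inv_mem hx), ?_⟩
      rw [commutatorElement_def, transgression_mul_right h _ (inv_mem hx)]
      have e1 := transgression_mul_left h y h1
      rw [inv_mul_cancel_right, transgression_mul_right h y hx] at e1
      have e2 := transgression_mul_right h x (inv_mem hx)
      rw [mul_inv_cancel] at e2
      linear_combination -e1 - e2
  exact (hle hx).2

/-- Such a `g` is constant on cosets of `K`, so it descends to a cochain of `G ⧸ K` whose coboundary
is the cocycle. Thus the homomorphism determines the class. -/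
theorem eq_zero_of_normalizedRestriction_eq_zero (h : (c, g) ∈ transgression K p)
    (hg : normalizedRestriction K p g = 0) : c = 0 := by
  have hinv : ∀ x, ∀ k ∈ K, g (x * k) = g x := by
    intro x k hk
    have := congrFun hg ⟨k, hk⟩
    rw [normalizedRestriction_apply, Pi.zero_apply] at this
    rw [transgression_mul_right h x hk]
    linear_combination this
  let g' : C(G ⧸ K, ZMod p) := ⟨Quotient.lift g fun a b hab => by
      have := hinv a _ (QuotientGroup.leftRel_apply.1 hab)
      rw [mul_inv_cancel_left] at this
      exact this.symm, g.continuous.quotient_lift _⟩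
  obtain ⟨f, rfl, h⟩ := h
  rw [QuotientAddGroup.eq_zero_iff]
  refine ⟨g', ?_⟩
  ext ⟨x, y⟩
  obtain ⟨x, rfl⟩ := QuotientGroup.mk_surjective x
  obtain ⟨y, rfl⟩ := QuotientGroup.mk_surjective y
  exact (h x y).symm

/-- If the cocycle is the coboundary of `u`, then `g - u` is a homomorphism `G → ℤ/p` and kills
`G^(2,p)`. Thus the class determines the homomorphism; here `n ≥ 2` is needed. -/
theorem normalizedRestriction_eq_zero (hK : K ≤ lowerPCentral p G 2)
    (h : ((0 : H2 p (G ⧸ K)), g) ∈ transgression K p) : normalizedRestriction K p g = 0 := by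
  obtain ⟨f, hf, h⟩ := h
  rw [QuotientAddGroup.eq_zero_iff] at hf
  obtain ⟨u, hu⟩ := hf
  have hmul : ∀ x y : G, g (x * y) - u ((x : G ⧸ K) * y) = (g x - u x) + (g y - u y) := by
    intro x y
    have h1 := h x y
    have h2 : u (y : G ⧸ K) - u ((x : G ⧸ K) * y) + u (x : G ⧸ K) = f.1 (x, y) :=
      DFunLike.congr_fun hu ((x : G ⧸ K), (y : G ⧸ K))
    linear_combination h2 + h1
  have hcont : Continuous fun x : G => g x - u (x : G ⧸ K) :=
    g.continuous.sub (u.continuous.comp QuotientGroup.continuous_mk)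
  let φ : G →* Multiplicative (ZMod p) := MonoidHom.mk'
    (fun x => Multiplicative.ofAdd (g x - u (x : G ⧸ K))) fun x y => by
      rw [← ofAdd_add, ← hmul]; rfl
  have hφ : lowerPCentral p G 2 ≤ φ.ker := by
    refine lowerPCentral_succ_le le_rfl ?_ ?_ ?_
    · have : IsClosed {x : G | g x - u (x : G ⧸ K) = 0} := isClosed_eq hcont continuous_const
      exact this
    · intro x _
      rw [MonoidHom.mem_ker, map_pow]
      apply Multiplicative.toAdd.injective
      simp
    · intro y x _
      rw [MonoidHom.mem_ker, map_commutatorElement, commutatorElement_eq_one_iff_mul_comm, mul_comm]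
  ext k
  have h1 : g k - u ((k : G) : G ⧸ K) = 0 := hφ (hK k.2)
  have h2 : g 1 - u ((1 : G) : G ⧸ K) = 0 := φ.map_one
  rw [(QuotientGroup.eq_one_iff (k : G)).2 k.2] at h1
  rw [normalizedRestriction_apply, Pi.zero_apply]
  rw [QuotientGroup.mk_one] at h2
  linear_combination h1 - h2

end

end Transgression

/-! ### Lifting through central extensions -/

section CentralExtension

variable {p : ℕ} {E Q : Type*} [Group E] [Group Q] (ω : GroupExtension (Multiplicative (ZMod p)) E Q)

theorem rightHom_extSection (q : Q) : ω.rightHom (extSection ω q) = q :=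
  Function.surjInv_eq ω.rightHom_surjective q

theorem exists_extCoordinate : ∃ A : E → ZMod p,
    ∀ M, ω.inl (Multiplicative.ofAdd (A M)) * extSection ω (ω.rightHom M) = M := by
  have : ∀ M, ∃ a : ZMod p,
      ω.inl (Multiplicative.ofAdd a) * extSection ω (ω.rightHom M) = M := by
    intro M
    have h : M * (extSection ω (ω.rightHom M))⁻¹ ∈ ω.inl.range := by
      rw [ω.range_inl_eq_ker_rightHom, MonoidHom.mem_ker]
      simp [rightHom_extSection]
    obtain ⟨a, ha⟩ := h
    exact ⟨a.toAdd, by rw [ofAdd_toAdd, ha]; group⟩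
  exact ⟨fun M => (this M).choose, fun M => (this M).choose_spec⟩

theorem inl_section_mul
    (hω : ∀ (a : Multiplicative (ZMod p)) (e : E), Commute (ω.inl a) e)
    (a b : ZMod p) (x y : Q) :
    (ω.inl (Multiplicative.ofAdd a) * extSection ω x) *
      (ω.inl (Multiplicative.ofAdd b) * extSection ω y) =
    ω.inl (Multiplicative.ofAdd (a + b + factorSet ω x y)) * extSection ω (x * y) := by
  rw [ofAdd_add, ofAdd_add, map_mul, map_mul, mul_assoc _ _ (extSection ω (x * y)),
    factorSet_spec]
  have := (hω (Multiplicative.ofAdd b) (extSection ω x)).eq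
  simp only [mul_assoc]
  congr 1
  rw [← mul_assoc, ← this, mul_assoc]

theorem extCoordinate_mul
    (hω : ∀ (a : Multiplicative (ZMod p)) (e : E), Commute (ω.inl a) e)
    {A : E → ZMod p}
    (hA : ∀ M, ω.inl (Multiplicative.ofAdd (A M)) * extSection ω (ω.rightHom M) = M) (M N : E) :
    A (M * N) = A M + A N + factorSet ω (ω.rightHom M) (ω.rightHom N) := by
  have h := inl_section_mul ω hω (A M) (A N) (ω.rightHom M) (ω.rightHom N)
  rw [hA, hA, ← map_mul] at h
  nth_rewrite 1 [← hA (M * N)] at h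
  exact Multiplicative.ofAdd.injective (ω.inl_injective (mul_right_cancel h))

variable {G : Type u} [Group G] [TopologicalSpace G] [IsTopologicalGroup G]
  {K : Subgroup G} [K.Normal] [TopologicalSpace E]
  [TopologicalSpace Q] [DiscreteTopology Q]

/-- If the pullback of the classifying element is inflated to zero, then the homomorphism lifts. -/
theorem exists_lift_of_transgression
    (hω : ∀ (a : Multiplicative (ZMod p)) (e : E), Commute (ω.inl a) e)
    (ρ : G ⧸ K →ₜ* Q) {g : C(G, ZMod p)}
    (h : (H2.map p ρ (classifyingElement ω hω), g) ∈ transgression K p) :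
    ∃ ρ' : G →ₜ* E, ∀ k : K, ρ' k =
      ω.inl (Multiplicative.ofAdd (-(normalizedRestriction K p g k))) := by
  obtain ⟨f, hf, h⟩ := h
  have hf' : (f : H2 p (G ⧸ K)) = ((contCocycles₂.pullback p ρ
    (⟨⟨fun x => factorSet ω x.1 x.2, continuous_of_discreteTopology⟩,
      factorSet_cocycle ω hω⟩ : contCocycles₂ p Q) : contCocycles₂ p (G ⧸ K)) : H2 p (G ⧸ K)) := hf
  rw [QuotientAddGroup.eq] at hf'
  obtain ⟨u, hu⟩ := hf'
  have hu' : ∀ x y : G ⧸ K, u y - u (x * y) + u x = -f.1 (x, y) + factorSet ω (ρ x) (ρ y) :=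
    fun x y => DFunLike.congr_fun hu (x, y)
  -- The coboundary of `g + u` is the pulled-back factor set, so its negative is the central
  -- correction that makes the section multiplicative.
  let a : G → ZMod p := fun x => -(g x + u (x : G ⧸ K))
  have ha : Continuous a :=
    (g.continuous.add (u.continuous.comp QuotientGroup.continuous_mk)).neg
  let ρ' : G →* E := MonoidHom.mk'
    (fun x => ω.inl (Multiplicative.ofAdd (a x)) * extSection ω (ρ (x : G ⧸ K))) fun x y => by
      rw [inl_section_mul ω hω, QuotientGroup.mk_mul, map_mul]
      congr 3
      have h1 := h x y
      have h2 := hu' x y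
      simp only [a, QuotientGroup.mk_mul]
      linear_combination h2 - h1
  have hρ' : Continuous ρ' :=
    (continuous_of_discreteTopology (f := fun q : ZMod p × Q =>
      ω.inl (Multiplicative.ofAdd q.1) * extSection ω q.2)).comp
      (ha.prodMk (ρ.continuous_toFun.comp QuotientGroup.continuous_mk))
  refine ⟨⟨ρ', hρ'⟩, fun k => ?_⟩
  have h1 : ω.inl (Multiplicative.ofAdd (a 1)) * extSection ω 1 = 1 := by
    have : ω.inl (Multiplicative.ofAdd (a 1)) * extSection ω (ρ ((1 : G) : G ⧸ K)) = 1 :=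
      ρ'.map_one
    rwa [QuotientGroup.mk_one, map_one] at this
  have h2 : ρ' k = ω.inl (Multiplicative.ofAdd (a k)) * extSection ω 1 := by
    change ω.inl (Multiplicative.ofAdd (a k)) * extSection ω (ρ ((k : G) : G ⧸ K)) = _
    rw [(QuotientGroup.eq_one_iff (k : G)).2 k.2, map_one]
  have h3 : a k = -(normalizedRestriction K p g k) + a 1 := by
    simp only [a, normalizedRestriction_apply, (QuotientGroup.eq_one_iff (k : G)).2 k.2,
      QuotientGroup.mk_one]
    ring
  change ρ' k = _
  rw [h2, h3, ofAdd_add, map_mul, mul_assoc, h1, mul_one]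

/-- The cochain is minus the central coordinate of the lift; by `extCoordinate_mul` its coboundary
is the pulled-back factor set. -/
theorem exists_transgression_of_lift [DiscreteTopology E]
    (hω : ∀ (a : Multiplicative (ZMod p)) (e : E), Commute (ω.inl a) e)
    (ρ : G ⧸ K →ₜ* Q) (ρ' : G →ₜ* E)
    (hρ : ∀ x, ω.rightHom (ρ' x) = ρ (x : G ⧸ K)) :
    ∃ g, (H2.map p ρ (classifyingElement ω hω), g) ∈ transgression K p ∧
      ∀ k : K, ρ' k = ω.inl (Multiplicative.ofAdd (-(normalizedRestriction K p g k))) := by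
  obtain ⟨A, hA⟩ := exists_extCoordinate ω
  let g : C(G, ZMod p) := ⟨fun x => -A (ρ' x),
    (continuous_of_discreteTopology (f := fun M => -A M)).comp ρ'.continuous_toFun⟩
  refine ⟨g, ⟨contCocycles₂.pullback p ρ
    (⟨⟨fun x => factorSet ω x.1 x.2, continuous_of_discreteTopology⟩,
      factorSet_cocycle ω hω⟩ : contCocycles₂ p Q), rfl, fun x y => ?_⟩, fun k => ?_⟩
  · change factorSet ω (ρ x) (ρ y) = -A (ρ' y) - -A (ρ' (x * y)) + -A (ρ' x)
    rw [map_mul, extCoordinate_mul ω hω hA, hρ, hρ]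
    ring
  · have h1 := hA 1
    have h2 := hA (ρ' k)
    have h3 : -(normalizedRestriction K p g k) = A (ρ' k) - A 1 := by
      change -(-A (ρ' k) - -A (ρ' 1)) = _
      rw [map_one]
      ring
    rw [map_one] at h1
    rw [hρ, (QuotientGroup.eq_one_iff (k : G)).2 k.2, map_one] at h2
    rw [h3, sub_eq_add_neg, ofAdd_add, ofAdd_neg, map_mul, map_inv]
    rw [eq_inv_of_mul_eq_one_right h1] at h2
    exact h2.symm

end CentralExtension

/-! ### Separation of points and finite duality over `ℤ/p` -/

section Separation

variable {p : ℕ} [Fact p.Prime]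

/-- The homomorphisms to `ℤ/p` separate the elements of an abelian group of exponent `p`. -/
theorem exists_additive_function_ne_zero {V : Type*} [CommGroup V] (hpow : ∀ v : V, v ^ p = 1) {v : V}
    (hv : v ≠ 1) : ∃ l : V → ZMod p, (∀ a b, l (a * b) = l a + l b) ∧ l v ≠ 0 := by
  let _ : Module (ZMod p) (Additive V) := AddCommGroup.zmodModule (n := p) fun x => hpow x.toMul
  by_contra! h
  refine hv (Additive.ofMul.injective ((Module.forall_dual_apply_eq_zero_iff (ZMod p)
    (Additive.ofMul v)).1 fun f => ?_))
  exact h (fun a => f (Additive.ofMul a)) (fun a b => by rw [ofMul_mul, map_add])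

/-- On a group with a central subgroup `V` of exponent `p`, a function that restricts to a translate of a
homomorphism on the cosets of `V` and separates a given element of `V` from `1`. -/
theorem exists_equivariant_function {Γ : Type*} [Group Γ] (V : Subgroup Γ)
    (hcentral : ∀ v ∈ V, ∀ x, x * v = v * x) (hpow : ∀ v ∈ V, v ^ p = 1) {v : Γ} (hv : v ∈ V)
    (hv1 : v ≠ 1) :
    ∃ g : Γ → ZMod p, (∀ x, ∀ k ∈ V, g (x * k) = g x + g k - g 1) ∧ g v ≠ g 1 := by
  let _ : CommGroup V :=
    { (inferInstance : Group V) with mul_comm := fun a b => Subtype.ext (hcentral b b.2 a) }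
  obtain ⟨ℓ, hℓmul, hℓ⟩ := exists_additive_function_ne_zero (p := p)
    (fun a : V => Subtype.ext (hpow a a.2)) (v := ⟨v, hv⟩) (fun h => hv1 (congrArg Subtype.val h))
  have hrep : ∀ x : Γ, ((x : Γ ⧸ V).out)⁻¹ * x ∈ V := fun x =>
    QuotientGroup.eq.1 (Quotient.out_eq (x : Γ ⧸ V))
  -- The value of `ℓ` on the `V`-component relative to a chosen coset representative.
  let g : Γ → ZMod p := fun x => ℓ ⟨((x : Γ ⧸ V).out)⁻¹ * x, hrep x⟩
  have hg : ∀ x, ∀ k (hk : k ∈ V), g (x * k) = g x + ℓ ⟨k, hk⟩ := by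
    intro x k hk
    have e : ((x * k : Γ) : Γ ⧸ V) = (x : Γ ⧸ V) := QuotientGroup.mk_mul_of_mem x hk
    simp only [g]
    rw [← hℓmul]
    congr 1
    apply Subtype.ext
    simp only [MulMemClass.mk_mul_mk]
    rw [e, mul_assoc]
  refine ⟨g, fun x k hk => ?_, fun h => hℓ ?_⟩
  · have h1 := hg 1 k hk
    rw [one_mul] at h1
    rw [hg x k hk, h1]
    ring
  · have h1 := hg 1 v hv
    rw [one_mul, h] at h1
    linear_combination -h1

variable {G : Type u} [Group G] [TopologicalSpace G] [IsTopologicalGroup G]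

/-- In a discrete quotient `G ⧸ L` where `k` survives and `G^(n+1,p)` does not, the image of `K` is
central of exponent `p`. The coboundary of an equivariant function there is constant on cosets of
`K` in both variables, hence descends to a cocycle of `G ⧸ K`. -/
theorem exists_transgression_separating (hG : ∀ U : Set G, IsOpen U → (1 : G) ∈ U →
      ∃ M : Subgroup G, M.Normal ∧ IsOpen (M : Set G) ∧ (M : Set G) ⊆ U)
    {n : ℕ} (hn : 1 ≤ n) {k : G} (hk : k ∈ lowerPCentral p G n)
    (hk' : k ∉ lowerPCentral p G (n + 1)) :
    ∃ c g, (c, g) ∈ transgression (lowerPCentral p G n) p ∧ g k ≠ g 1 := by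
  obtain ⟨M, hMn, hMo, hM⟩ := exists_open_normal_not_mem_sup hG
    (isClosed_lowerPCentral (p := p) (n + 1)) hk'
  set L := lowerPCentral p G (n + 1) ⊔ M with hL
  set K := lowerPCentral p G n with hK
  have hLo : IsOpen (L : Set G) := Subgroup.isOpen_mono le_sup_right hMo
  have hLd : DiscreteTopology (G ⧸ L) := QuotientGroup.discreteTopology hLo
  have hCL : lowerPCentral p G (n + 1) ≤ L := le_sup_left
  have hcentral : ∀ v ∈ K.map (QuotientGroup.mk' L), ∀ x, x * v = v * x := by
    rintro _ ⟨v, hv, rfl⟩ x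
    obtain ⟨x, rfl⟩ := QuotientGroup.mk'_surjective L x
    rw [← commutatorElement_eq_one_iff_mul_comm, ← map_commutatorElement]
    exact (QuotientGroup.eq_one_iff _).2 (hCL (commutator_mem_lowerPCentral hn x hv))
  obtain ⟨g₀, hg₀, hne⟩ := exists_equivariant_function (p := p) (K.map (QuotientGroup.mk' L))
    hcentral (by
      rintro _ ⟨v, hv, rfl⟩
      rw [← map_pow]
      exact (QuotientGroup.eq_one_iff _).2 (hCL (pow_mem_lowerPCentral hn hv)))
    (Subgroup.mem_map_of_mem _ hk) (fun h => hM ((QuotientGroup.eq_one_iff k).1 h))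
  let g : C(G, ZMod p) := ⟨fun x => g₀ (QuotientGroup.mk' L x),
    (continuous_of_discreteTopology (f := g₀)).comp QuotientGroup.continuous_mk⟩
  have hg : ∀ x, ∀ y ∈ K, g (x * y) = g x + g y - g 1 := fun x y hy => by
    change g₀ (QuotientGroup.mk' L (x * y)) = _
    rw [map_mul, hg₀ _ _ (Subgroup.mem_map_of_mem _ hy)]
    rfl
  have hcomm : ∀ x y, ∀ a ∈ K, g (x * a * y) = g (x * y * a) := fun x y a ha => by
    change g₀ (QuotientGroup.mk' L (x * a * y)) = g₀ (QuotientGroup.mk' L (x * y * a))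
    simp only [map_mul]
    rw [mul_assoc, ← hcentral _ (Subgroup.mem_map_of_mem _ ha), ← mul_assoc]
  let F : G × G → ZMod p := fun q => g q.2 - g (q.1 * q.2) + g q.1
  have hF : ∀ x y, ∀ a ∈ K, ∀ b ∈ K, F (x * a, y * b) = F (x, y) := fun x y a ha b hb => by
    simp only [F]
    rw [← mul_assoc, hg _ b hb, hg _ b hb, hcomm x y a ha, hg _ a ha, hg _ a ha]
    ring
  let f₀ : (G ⧸ K) × (G ⧸ K) → ZMod p := fun q => F (q.1.out, q.2.out)
  have hf₀ : ∀ x y : G, f₀ ((x : G ⧸ K), (y : G ⧸ K)) = F (x, y) := fun x y => by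
    have hout : ∀ x : G, ∃ a ∈ K, (x : G ⧸ K).out = x * a := fun x =>
      ⟨x⁻¹ * (x : G ⧸ K).out, QuotientGroup.eq.1 (Quotient.out_eq (x : G ⧸ K)).symm, by group⟩
    obtain ⟨a, ha, ea⟩ := hout x
    obtain ⟨b, hb, eb⟩ := hout y
    simp only [f₀]
    rw [ea, eb, hF x y a ha b hb]
  have hcont : Continuous f₀ := by
    rw [← (QuotientGroup.isOpenQuotientMap_mk.prodMap
      QuotientGroup.isOpenQuotientMap_mk).continuous_comp_iff]
    have : f₀ ∘ Prod.map QuotientGroup.mk QuotientGroup.mk = F := funext fun q => hf₀ q.1 q.2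
    rw [this]
    fun_prop
  let f : contCocycles₂ p (G ⧸ K) := ⟨⟨f₀, hcont⟩, by
    intro x y z
    obtain ⟨x, rfl⟩ := QuotientGroup.mk_surjective x
    obtain ⟨y, rfl⟩ := QuotientGroup.mk_surjective y
    obtain ⟨z, rfl⟩ := QuotientGroup.mk_surjective z
    simp only [ContinuousMap.coe_mk, ← QuotientGroup.mk_mul, hf₀, F]
    rw [mul_assoc]
    ring⟩
  exact ⟨f, g, ⟨f, rfl, hf₀⟩, hne⟩

/-- A homomorphism to `ℤ/p` that vanishes on the common kernel of finitely many homomorphisms is a linear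
combination of them. -/
theorem mem_of_iInf_ker_le_ker {H : Type*} [Group H] (W : AddSubgroup (H → ZMod p))
    (hW : ∀ μ ∈ W, ∀ x y, μ (x * y) = μ x + μ y) (t : Finset (H → ZMod p)) (ht : ∀ μ ∈ t, μ ∈ W) :
    ∀ l : H → ZMod p, (∀ x y, l (x * y) = l x + l y) →
      (∀ x, (∀ μ ∈ t, μ x = 0) → l x = 0) → l ∈ W := by
  classical
  have hpow : ∀ l : H → ZMod p, (∀ x y, l (x * y) = l x + l y) → ∀ x (m : ℕ),
      l (x ^ m) = m * l x := by
    intro l hl x m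
    induction m with
    | zero =>
      have := hl 1 1
      rw [mul_one] at this
      simpa using this
    | succ m ih =>
      rw [pow_succ, hl, ih]
      push_cast
      ring
  induction t using Finset.induction_on with
  | empty =>
    intro l _ h
    have : l = 0 := funext fun x => h x (by simp)
    rw [this]
    exact W.zero_mem
  | insert μ t _ ih =>
    intro l hl h
    have hμW : μ ∈ W := ht μ (Finset.mem_insert_self μ t)
    have ih := ih fun ν hν => ht ν (Finset.mem_insert_of_mem hν)
    by_cases hμ : ∀ x, (∀ ν ∈ t, ν x = 0) → μ x = 0
    · refine ih l hl fun x hx => h x fun ν hν => ?_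
      rcases Finset.mem_insert.1 hν with rfl | hν
      · exact hμ x hx
      · exact hx ν hν
    · push Not at hμ
      obtain ⟨x₀, hx₀, hμ₀⟩ := hμ
      -- With this `a`, `l - a μ` vanishes at `x₀`. Any `x` in the common kernel of `t` can be
      -- multiplied by a power of `x₀` to lie in the kernel of `μ` too, where `l` vanishes; so `l -
      -- a μ` vanishes at `x`.
      let a : ZMod p := l x₀ / μ x₀
      have h1 : l - a.val • μ ∈ W := by
        refine ih _ (fun x y => ?_) fun x hx => ?_
        · simp only [Pi.sub_apply, Pi.smul_apply, hl, hW μ hμW, smul_add]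
          ring
        · let b : ZMod p := -(μ x / μ x₀)
          have key : ∀ ν : H → ZMod p, (∀ x y, ν (x * y) = ν x + ν y) →
              ν (x * x₀ ^ b.val) = ν x + b * ν x₀ := fun ν hν => by
            rw [hν, hpow ν hν, ZMod.natCast_zmod_val]
          have h2 : l (x * x₀ ^ b.val) = 0 := by
            refine h _ fun ν hν => ?_
            rcases Finset.mem_insert.1 hν with rfl | hν
            · rw [key _ (hW _ hμW)]
              simp only [b]
              field_simp
              ring
            · rw [key _ (hW _ (ht ν (Finset.mem_insert_of_mem hν))), hx ν hν, hx₀ ν hν]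
              ring
          rw [key l hl] at h2
          rw [Pi.sub_apply, Pi.smul_apply, nsmul_eq_mul, ZMod.natCast_zmod_val, ← h2]
          simp only [a, b]
          field_simp
          ring
      have h2 := W.add_mem h1 (W.nsmul_mem hμW a.val)
      rwa [sub_add_cancel] at h2

end Separation

/-! ### Unitriangular classes and the proof of the theorem -/

section Main

variable {p : ℕ} [Fact p.Prime] {n : ℕ} {G : Type u} [Group G] [TopologicalSpace G]
  [IsTopologicalGroup G]

theorem omegaInl_injective (p s m : ℕ) [Fact p.Prime] [NeZero s] :
    Function.Injective (omegaInl p s m) :=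
  cornerHom_injective.comp (zmodEmb_injective p m)

/-- The class gives a lift `G → U` whose restriction to `K` is the transgressed homomorphism up to
sign, and this lift kills `TSub`. -/
theorem apply_eq_apply_one_of_mem_TSub {K : Subgroup G} [K.Normal] {c : H2 p (G ⧸ K)}
    (hc : c ∈ unitriangularElements p n (G ⧸ K)) {g : C(G, ZMod p)}
    (h : (c, g) ∈ transgression K p) {x : G} (hx : x ∈ TSub p n G) (hxK : x ∈ K) :
    g x = g 1 := by
  obtain ⟨k, ρ, rfl⟩ := hc
  obtain ⟨ρ', hρ'⟩ := exists_lift_of_transgression (omegaExt p ((k : ℕ) + 1) (n - ((k : ℕ) + 1)))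
    (omegaInl_commute p _ _) ρ h
  have h1 := hρ' ⟨x, hxK⟩
  have h2 : ρ' x = 1 := mem_TSub_iff.1 hx ((k : ℕ) + 1) (n - ((k : ℕ) + 1) + 1) (by omega)
    (by omega) (by omega) ρ'
  have h3 := omegaInl_injective p _ _ ((map_one _).trans (h2.symm.trans h1))
  have h4 := congrArg Multiplicative.toAdd h3
  rw [toAdd_one, toAdd_ofAdd, normalizedRestriction_apply] at h4
  linear_combination h4

/-- The reduction of `ρ` to `Ū` factors through `G ⧸ G^(n,p)`, and `ρ` is itself a lift of it. -/
theorem exists_unitriangular_of_rep (k : Fin n)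
    (ρ : G →ₜ* UT ((k : ℕ) + 1) (ZMod (p ^ (n - ((k : ℕ) + 1) + 1)))) :
    ∃ c ∈ unitriangularElements p n (G ⧸ lowerPCentral p G n), ∃ g,
      (c, g) ∈ transgression (lowerPCentral p G n) p ∧
        ∀ x : G, x ∈ lowerPCentral p G n → g x = g 1 → ρ x = 1 := by
  let ρ₁ : G →ₜ* UTBar p ((k : ℕ) + 1) (n - ((k : ℕ) + 1)) :=
    ρ.compDiscrete (QuotientGroup.mk' _)
  have h1 : ∀ x ∈ lowerPCentral p G n, ρ₁ x = 1 := fun x hx =>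
    mk_comp_lowerPCentral (n := n) (by omega) (Nat.one_le_of_lt k.2) ρ₁ hx
  obtain ⟨g, hg, hρ⟩ := exists_transgression_of_lift
    (omegaExt p ((k : ℕ) + 1) (n - ((k : ℕ) + 1))) (omegaInl_commute p _ _)
    (ρ₁.quotientLift (lowerPCentral p G n) h1) ρ (fun x => rfl)
  refine ⟨_, ⟨k, _, rfl⟩, g, hg, fun x hx hgx => ?_⟩
  refine (hρ ⟨x, hx⟩).trans ?_
  rw [normalizedRestriction_apply, hgx, sub_self, neg_zero, ofAdd_zero, map_one]

/-- A point of `TSub` outside `G^(n+1,p)` would be detected by some class in the kernel, whereas the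
homomorphisms of all generators vanish there; this contradicts uniqueness of the homomorphism of a
class. -/
theorem TSub_eq_of_closure_eq (hG : ∀ U : Set G, IsOpen U → (1 : G) ∈ U →
      ∃ M : Subgroup G, M.Normal ∧ IsOpen (M : Set G) ∧ (M : Set G) ⊆ U) (hn : 2 ≤ n)
    (hT : TSub p n G ≤ lowerPCentral p G n)
    {A : Set (H2 p (G ⧸ lowerPCentral p G n))}
    (hA : A ⊆ unitriangularElements p n (G ⧸ lowerPCentral p G n))
    (hAker : AddSubgroup.closure A = (H2.inflation p (lowerPCentral p G n)).ker) :
    TSub p n G = lowerPCentral p G (n + 1) := by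
  refine le_antisymm (fun x hx => ?_) lowerPCentral_le_TSub
  by_contra hx'
  have hxK := hT hx
  obtain ⟨c, g, hcg, hgx⟩ := exists_transgression_separating hG (by omega) hxK hx'
  have hc : c ∈ AddSubgroup.closure A := by
    rw [hAker, mem_ker_inflation_iff]
    exact ⟨g, hcg⟩
  have key : ∃ g', (c, g') ∈ transgression (lowerPCentral p G n) p ∧ g' x = g' 1 := by
    clear hcg
    have hAle : A ⊆ (H2.inflation p (lowerPCentral p G n)).ker :=
      hAker ▸ AddSubgroup.subset_closure
    induction hc using AddSubgroup.closure_induction with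
    | mem a ha =>
      obtain ⟨g', hg'⟩ := mem_ker_inflation_iff.1 (hAle ha)
      exact ⟨g', hg', apply_eq_apply_one_of_mem_TSub (hA ha) hg' hx hxK⟩
    | zero => exact ⟨0, AddSubgroup.zero_mem _, rfl⟩
    | add a b _ _ iha ihb =>
      obtain ⟨g₁, h1, e1⟩ := iha
      obtain ⟨g₂, h2, e2⟩ := ihb
      exact ⟨g₁ + g₂, AddSubgroup.add_mem _ h1 h2, by simp [e1, e2]⟩
    | neg a _ iha =>
      obtain ⟨g₁, h1, e1⟩ := iha
      exact ⟨-g₁, AddSubgroup.neg_mem _ h1, by simp [e1]⟩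
  obtain ⟨g', hcg', hg'x⟩ := key
  have hdiff := AddSubgroup.sub_mem _ hcg hcg'
  rw [Prod.mk_sub_mk, sub_self] at hdiff
  have h0 := congrFun (normalizedRestriction_eq_zero (lowerPCentral_antitone (by omega) hn) hdiff)
    ⟨x, hxK⟩
  rw [normalizedRestriction_apply, Pi.zero_apply, ContinuousMap.sub_apply,
    ContinuousMap.sub_apply] at h0
  exact hgx (by linear_combination h0 + hg'x)

theorem closure_eq_of_TSub_eq [CompactSpace G] (hn : 2 ≤ n)
    (hT : TSub p n G = lowerPCentral p G (n + 1)) :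
    AddSubgroup.closure (unitriangularElements p n (G ⧸ lowerPCentral p G n) ∩
        (H2.inflation p (lowerPCentral p G n)).ker) =
      (H2.inflation p (lowerPCentral p G n)).ker := by
  classical
  set K := lowerPCentral p G n with hK
  set A := unitriangularElements p n (G ⧸ K) ∩ (H2.inflation p K).ker
  refine le_antisymm ((AddSubgroup.closure_le _).2 Set.inter_subset_right) fun c hc => ?_
  obtain ⟨g, hcg⟩ := mem_ker_inflation_iff.1 hc
  -- The homomorphisms on `K` that come from classes in the subgroup generated by `A`.
  let W : AddSubgroup (K → ZMod p) :=
    ((transgression K p ⊓ (AddSubgroup.closure A).comap (AddMonoidHom.fst _ _)).map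
      ((normalizedRestriction K p).comp (AddMonoidHom.snd _ _)))
  have hW : ∀ μ ∈ W, ∀ x y, μ (x * y) = μ x + μ y := by
    rintro _ ⟨⟨c', g'⟩, ⟨h1, -⟩, rfl⟩ x y
    exact normalizedRestriction_mul h1 x y
  have hcover : ∀ x : K, normalizedRestriction K p g x ≠ 0 →
      ∃ μ ∈ W, μ x ≠ 0 ∧ Continuous μ := by
    intro x hx
    have hx' : (x : G) ∉ TSub p n G := by
      rw [hT]
      intro h
      apply hx
      rw [normalizedRestriction_apply, apply_of_mem_lowerPCentral_succ (by omega) hK hcg h,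
        sub_self]
    simp only [TSub, kernelIntersection, Subgroup.mem_iInf, not_forall] at hx'
    obtain ⟨k, ρ, hρ⟩ := hx'
    obtain ⟨c', hc', g', hcg', h⟩ := exists_unitriangular_of_rep k ρ
    refine ⟨normalizedRestriction K p g', ⟨(c', g'), ⟨hcg', AddSubgroup.subset_closure
      ⟨hc', mem_ker_inflation_iff.2 ⟨g', hcg'⟩⟩⟩, rfl⟩, fun h0 => hρ (h x x.2 ?_), ?_⟩
    · rw [normalizedRestriction_apply] at h0
      exact sub_eq_zero.1 h0
    · exact (g'.continuous.comp continuous_subtype_val).sub continuous_const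
  have : CompactSpace K := isCompact_iff_compactSpace.1
    (isClosed_lowerPCentral (p := p) (G := G) n).isCompact
  have hgc : Continuous (normalizedRestriction K p g) :=
    (g.continuous.comp continuous_subtype_val).sub continuous_const
  -- The set where the given homomorphism is nonzero is compact, so finitely many members of `W`
  -- detect all of it and finite duality applies.
  have hZ : IsCompact {x : K | normalizedRestriction K p g x ≠ 0} :=
    ((isClosed_discrete {a : ZMod p | a ≠ 0}).preimage hgc).isCompact
  choose! μ hμW hμne hμc using hcover
  obtain ⟨t, ht, hcov⟩ := hZ.elim_nhds_subcover (fun x => {y | μ x y ≠ 0}) fun x hx =>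
    ((isOpen_discrete {a : ZMod p | a ≠ 0}).preimage (hμc x hx)).mem_nhds (hμne x hx)
  have hmem : normalizedRestriction K p g ∈ W := by
    refine mem_of_iInf_ker_le_ker W hW (t.image μ) (fun ν hν => ?_) _
      (normalizedRestriction_mul hcg) fun x hx => ?_
    · obtain ⟨x, hx, rfl⟩ := Finset.mem_image.1 hν
      exact hμW x (ht x hx)
    · by_contra hne
      obtain ⟨y, hy, hxy⟩ := Set.mem_iUnion₂.1 (hcov hne)
      exact hxy (hx _ (Finset.mem_image_of_mem _ hy))
  obtain ⟨⟨c', g'⟩, ⟨h1, h2⟩, h3⟩ := hmem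
  have hdiff := AddSubgroup.sub_mem _ hcg h1
  have hzero : normalizedRestriction K p (g - g') = 0 := by
    rw [map_sub, sub_eq_zero]
    exact h3.symm
  have e : c = c' := sub_eq_zero.1 (eq_zero_of_normalizedRestriction_eq_zero hdiff hzero)
  rw [e]
  exact h2

end Main

theorem theorem10p3 (p : ℕ) [Fact p.Prime] (n : ℕ) (hn : 2 ≤ n)
    (S : Type u) [Group S] [TopologicalSpace S] [IsTopologicalGroup S] [CompactSpace S]
    [TotallyDisconnectedSpace S] (hS : IsFreeProfinite S)
    (N : Subgroup S) [N.Normal] (hNclosed : IsClosed (N : Set S)) (hN : N ≤ lowerPCentral p S n) :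
    TBarSub p n (S ⧸ N) = lowerPCentral p (S ⧸ N) n ∧
    (TSub p n (S ⧸ N) = lowerPCentral p (S ⧸ N) (n + 1) ↔
      ∃ A ⊆ unitriangularElements p n ((S ⧸ N) ⧸ lowerPCentral p (S ⧸ N) n),
        AddSubgroup.closure A = (H2.inflation p (lowerPCentral p (S ⧸ N) n)).ker) := by
  -- With `n = m + 1`, the hypothesis on `N` is the one that `TSub_quotient_le` needs at stage `m`;
  -- both `T̄_{m+1}` and `T_{m+1}` are contained in `T_m`.
  obtain ⟨m, rfl⟩ := Nat.exists_eq_add_of_le' (by omega : 1 ≤ n)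
  have hT : TSub p m (S ⧸ N) ≤ lowerPCentral p (S ⧸ N) (m + 1) :=
    TSub_quotient_le (TSub_le_lowerPCentral_of_isFreeProfinite p m hS) N hN
  refine ⟨le_antisymm (TBarSub_succ_le.trans hT) lowerPCentral_le_TBarSub, fun h => ?_, ?_⟩
  · exact ⟨_, Set.inter_subset_left, closure_eq_of_TSub_eq hn h⟩
  · rintro ⟨A, hA, hAker⟩
    exact TSub_eq_of_closure_eq
      (exists_open_normal_quotient exists_open_normal_of_profinite N) hn
      (TSub_succ_le.trans hT) hA hAker
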